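/- All systems are finite dimensional and nonzero, and $\log=\log_2$. A bipartite channel $\mathcal N_{AB}$ is a completely positive trace-preserving map from operators on $A_0B_0$ to operators on $A_1B_1$. It is \emph{separable}, $\mathcal N\in\mathrm{SEPC}(A{:}B)$, if it has finitely many Kraus operators, all of the product form $S_i\otimes T_i$ with $S_i:A_0\to A_1$ and $T_i:B_0\to B_1$. A \emph{superchannel} is a linear supermap of the form $\Theta[\mathcal N]=\mathcal F^{\rm post}\circ(\mathcal N\otimes\mathrm{id}_E)\circ\mathcal F^{\rm pre}$ with channels $\mathcal F^{\rm pre},\mathcal F^{\rm post}$ and a finite-dimensional memory $E$; it is \emph{separability-preserving} (SEPPSC) if it maps separable channels to separable channels. Let $\mathcal F^K(X)=FXF^\dagger$, $F=\sum_{i,j<K}|ij\rangle\langle ji|$, be the $K$-swap channel (all four systems being $\mathbb C^K$), and $\|\cdot\|_\diamond$ the diamond norm. For $\varepsilon\ge 0$ put, with values in $[-\infty,+\infty]$ and $-\log 0=+\infty$, $$E_D^{(1),\varepsilon}(\mathcal N)=\sup\Bigl\{\log K^2:\ K\in\mathbb N,\ K\ge 1,\ \exists\,\Theta\in\mathrm{SEPPSC},\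 \tfrac12\|\Theta[\mathcal N]-\mathcal F^K\|_\diamond\le\varepsilon\Bigr\},$$ $$E_H^{\varepsilon}(\mathcal N)=\sup_{\Psi_{A_0B_0R_0}}\ \sup_{\substack{0\le Q\le I_{A_1B_1R_0}\\ \operatorname{tr}\{Q\,(\mathcal N\otimes\mathrm{id})(\Psi)\}\ge 1-\varepsilon}}\ \inf_{\mathcal M\in\mathrm{SEPC}(A:B)}\bigl\{-\log\operatorname{tr}\bigl(Q\,(\mathcal M\otimes\mathrm{id})(\Psi)\bigr)\bigr\},$$ where $\Psi$ runs over pure states with an arbitrary finite-dimensional reference $R_0$. \textbf{Theorem.} Let $\varepsilon\ge 0$ and let $\mathcal N=\mathcal N_{AB}$ be a bipartite quantum channel. Then $$E_D^{(1),\varepsilon}(\mathcal N)\le E_H^{2\varepsilon}(\mathcal N).$$ If $\varepsilon<1$, then $E_H^\varepsilon(\mathcal N)$ is finite and non-negative, and: (a) if $\lfloor E_H^\varepsilon(\mathcal N)\rfloor$ is even, then $E_D^{(1),\varepsilon}(\mathcal N)\ge\lfloor E_H^\varepsilon(\mathcal N)\rfloor$; (b) if $\lfloor E_H^\varepsilon(\mathcal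 N)\rfloor$ is odd, then $E_D^{(1),\varepsilon}(\mathcal N)\ge\lfloor E_H^\varepsilon(\mathcal N)\rfloor-1$, and if moreover $E_H^\varepsilon(\mathcal N)\ge\log 9$, then even $E_D^{(1),\varepsilon}(\mathcal N)\ge E_H^\varepsilon(\mathcal N)-1$. If $\varepsilon\ge 1$, then $E_H^\varepsilon(\mathcal N)=E_D^{(1),\varepsilon}(\mathcal N)=+\infty$. -/

import Mathlib

open scoped Kronecker Matrix ENNReal ComplexOrder

namespace DynEnt

noncomputable section

/-- Linear maps from operators on `ℂ^m` to operators on `ℂ^n`; the index types of a bipartite system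
are products. -/
abbrev OpMap (m n : Type*) := Matrix m m ℂ →ₗ[ℂ] Matrix n n ℂ

/-- The map `T ⊗ id_r`, applied to an operator on the system together with a reference `r`. -/
def applyLeft {m n r : Type*} (T : OpMap m n) (X : Matrix (m × r) (m × r) ℂ) :
    Matrix (n × r) (n × r) ℂ :=
  Matrix.of fun p q => T (Matrix.of fun k l => X (k, p.2) (l, q.2)) p.1 q.1

/-- Complete positivity: `T ⊗ id_r` is positive for all finite-dimensional references. -/
def IsCompletelyPositive {m n : Type*} (T : OpMap m n) : Prop :=
  ∀ (r : ℕ) (X : Matrix (m × Fin r) (m × Fin r) ℂ), X.PosSemidef → (applyLeft T X).PosSemidef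

def IsTracePreserving {m n : Type*} [Fintype m] [Fintype n] (T : OpMap m n) : Prop :=
  ∀ X, (T X).trace = X.trace

/-- Quantum channels: completely positive trace-preserving maps. -/
structure IsChannel {m n : Type*} [Fintype m] [Fintype n] (T : OpMap m n) : Prop where
  completelyPositive : IsCompletelyPositive T
  tracePreserving : IsTracePreserving T

/-- Separable channels: trace-preserving maps with finitely many Kraus operators of the product form
`S i ⊗ T i`, the first factor acting `A₀ → A₁` and the second one `B₀ → B₁`. -/
def IsSeparableChannel {A₀ B₀ A₁ B₁ : Type*} [Fintype A₀] [Fintype B₀] [Fintype A₁] [Fintype B₁]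
    (M : OpMap (A₀ × B₀) (A₁ × B₁)) : Prop :=
  IsTracePreserving M ∧
    ∃ (k : ℕ) (S : Fin k → Matrix A₁ A₀ ℂ) (T : Fin k → Matrix B₁ B₀ ℂ),
      ∀ X, M X = ∑ i, (S i ⊗ₖ T i) * X * (S i ⊗ₖ T i)ᴴ

/-- Linear supermaps from maps `m → n` to maps `m' → n'`. -/
abbrev Supermap (m n m' n' : Type*) := OpMap m n →ₗ[ℂ] OpMap m' n'

/-- Superchannels: `Θ[N] = post ∘ (N ⊗ id_E) ∘ pre` with channels `pre`, `post` and a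
finite-dimensional memory `E`. -/
def IsSuperchannel {m n m' n' : Type*} [Fintype m] [Fintype n] [Fintype m'] [Fintype n']
    (Θ : Supermap m n m' n') : Prop :=
  ∃ (e : ℕ) (pre : OpMap m' (m × Fin e)) (post : OpMap (n × Fin e) n'),
    IsChannel pre ∧ IsChannel post ∧
      ∀ (N : OpMap m n) (X : Matrix m' m' ℂ), Θ N X = post (applyLeft N (pre X))

/-- Separability-preserving superchannels. -/
def IsSEPPSC {A₀ B₀ A₁ B₁ A₀' B₀' A₁' B₁' : Type*}
    [Fintype A₀] [Fintype B₀] [Fintype A₁] [Fintype B₁]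
    [Fintype A₀'] [Fintype B₀'] [Fintype A₁'] [Fintype B₁']
    (Θ : Supermap (A₀ × B₀) (A₁ × B₁) (A₀' × B₀') (A₁' × B₁')) : Prop :=
  IsSuperchannel Θ ∧ ∀ M, IsSeparableChannel M → IsSeparableChannel (Θ M)

/-- The trace norm: the sum of the singular values. -/
def traceNorm {m : Type*} [Fintype m] [DecidableEq m] (X : Matrix m m ℂ) : ℝ :=
  ∑ i, Real.sqrt ((Matrix.isHermitian_conjTranspose_mul_self X).eigenvalues i)

/-- The diamond norm: the supremum of `‖(T ⊗ id_r) X‖₁` over all finite-dimensional references `r`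
and all operators `X` of trace norm at most one. -/
def diamondNorm {m n : Type*} [Fintype m] [DecidableEq m] [Fintype n] [DecidableEq n]
    (T : OpMap m n) : ℝ≥0∞ :=
  ⨆ (r : ℕ) (X : Matrix (m × Fin r) (m × Fin r) ℂ) (_ : traceNorm X ≤ 1),
    ENNReal.ofReal (traceNorm (applyLeft T X))

/-- The swap gate `∑ i j, |i j⟩⟨j i|` on `ℂ^K ⊗ ℂ^K`. -/
def swapGate (K : ℕ) : Matrix (Fin K × Fin K) (Fin K × Fin K) ℂ :=
  Matrix.of fun p q => if p = q.swap then 1 else 0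

/-- The `K`-swap channel `X ↦ F X F†`. -/
def swapChannel (K : ℕ) : OpMap (Fin K × Fin K) (Fin K × Fin K) where
  toFun X := swapGate K * X * (swapGate K)ᴴ
  map_add' X Y := by rw [mul_add, add_mul]
  map_smul' c X := by simp

/-- `-log₂ x` for `x ≥ 0`, with the value `+∞` at `0`. -/
def negLog2 (x : ℝ) : EReal := if x ≤ 0 then ⊤ else ((-Real.logb 2 x : ℝ) : EReal)

/-- The density matrix `|ψ⟩⟨ψ|`. -/
def pureState {m : Type*} (ψ : m → ℂ) : Matrix m m ℂ := Matrix.vecMulVec ψ (star ψ)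

/-- The probability `tr (Q · (N ⊗ id_R)(|ψ⟩⟨ψ|))`. -/
def testProb {m n r : Type*} [Fintype n] [Fintype r] (N : OpMap m n) (ψ : m × r → ℂ)
    (Q : Matrix (n × r) (n × r) ℂ) : ℝ :=
  (Q * applyLeft N (pureState ψ)).trace.re

/-- The hypothesis-testing relative entropy of dynamic entanglement `E_H^ε(N)`: the supremum over
pure states `ψ` with an arbitrary finite-dimensional reference and over tests `0 ≤ Q ≤ 1` with
`tr (Q N(ψ)) ≥ 1 - ε` of the infimum over separable channels `M` of `-log₂ tr (Q M(ψ))`. -/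
def hypTestEnt {A₀ B₀ A₁ B₁ : Type*} [Fintype A₀] [Fintype B₀] [Fintype A₁] [Fintype B₁]
    [DecidableEq A₁] [DecidableEq B₁] (ε : ℝ) (N : OpMap (A₀ × B₀) (A₁ × B₁)) : EReal :=
  ⨆ (r : ℕ) (ψ : (A₀ × B₀) × Fin r → ℂ) (_ : ∑ i, ‖ψ i‖ ^ 2 = 1)
    (Q : Matrix ((A₁ × B₁) × Fin r) ((A₁ × B₁) × Fin r) ℂ)
    (_ : Q.PosSemidef ∧ (1 - Q).PosSemidef ∧ 1 - ε ≤ testProb N ψ Q),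
    ⨅ (M : OpMap (A₀ × B₀) (A₁ × B₁)) (_ : IsSeparableChannel M), negLog2 (testProb M ψ Q)

/-- The one-shot distillable dynamic entanglement `E_D^{(1),ε}(N)` under SEPPSC: the supremum of
`log₂ K²` over the `K ≥ 1` whose `K`-swap channel is obtained from `N` by some SEPPSC up to error
`ε` in half the diamond norm. -/
def distillableEnt {A₀ B₀ A₁ B₁ : Type*} [Fintype A₀] [Fintype B₀] [Fintype A₁] [Fintype B₁]
    (ε : ℝ) (N : OpMap (A₀ × B₀) (A₁ × B₁)) : EReal :=
  sSup {x | ∃ (K : ℕ) (Θ : Supermap (A₀ × B₀) (A₁ × B₁) (Fin K × Fin K) (Fin K × Fin K)),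
    1 ≤ K ∧ IsSEPPSC Θ ∧ 2⁻¹ * diamondNorm (Θ N - swapChannel K) ≤ ENNReal.ofReal ε ∧
      x = ((Real.logb 2 ((K : ℝ) ^ 2) : ℝ) : EReal)}

end

end DynEnt

set_option linter.unusedSectionVars false

namespace DynEnt

open Matrix

/-! ### Positive matrices, singular values and the trace norm. -/

section LinearAlgebra

variable {l m n : Type*} [Fintype l] [Fintype m] [Fintype n]

/-! The number `K⁻²` plays two roles. It bounds the overlap of any separable channel with the
`K`-swap, and the swap mixed with a suitable separable channel `G` stays separable as long as its
weight is at most `K⁻²`. The first fact gives the converse, the second one achievability.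

Converse (`distillableEnt_le`). If `Θ[N]` is close to the swap, feed it half of a maximally
entangled state and test with the projector `P` onto the Choi state of the swap. The swap passes
with certainty, so `Θ[N]` passes with probability at least `1 - 2ε`. For separable `M` the channel
`Θ[M]` is separable and passes with probability at most `K⁻²` (`re_trace_swapState_le`, by
Cauchy–Schwarz on the Kraus operators). Pulling `P` back through the post-processing and purifying
the pre-processed state gives an admissible pair for `E_H`.

Achievability (`le_distillableEnt_of_test`). Given a state and a test that separable channels pass
with probability at most `K⁻²`, run the test on the given channel, then apply the swap on acceptance
and `G` on rejection. A channel with pass probability `p` becomes `p F + (1 - p) G`. This is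
separable if the channel was, and for `N` it is within `1 - p ≤ ε` of the swap. That `G` works rests
on `isSeparableChannel_threshold`, which writes the mixture at weight `K⁻²` as an average of local
operators with random phases.

It remains to produce a test of the exact value `E_H`. A Schmidt decomposition bounds the reference
(`exists_small_reference`), after which compactness yields an optimal pair (`exists_optimal_test`).
So every `K` with `log K² ≤ E_H` is distillable, and the parity cases are a choice of integer `K`.
Finiteness holds because the depolarizing channel is separable and a multiple of it dominates every
channel. -/

theorem re_trace_nonneg {A : Matrix m m ℂ} (hA : A.PosSemidef) : 0 ≤ A.trace.re :=
  (Complex.le_def.1 hA.trace_nonneg).1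

theorem exists_sum_pureState {A : Matrix m m ℂ} (hA : A.PosSemidef) :
    ∃ (k : ℕ) (v : Fin k → m → ℂ), A = ∑ i, pureState (v i) :=
  Matrix.posSemidef_iff_eq_sum_vecMulVec.1 hA

theorem posSemidef_pureState (v : m → ℂ) : (pureState v).PosSemidef :=
  posSemidef_vecMulVec_self_star v

theorem trace_mul_pureState (A : Matrix m m ℂ) (v : m → ℂ) :
    (A * pureState v).trace = star v ⬝ᵥ (A *ᵥ v) := by
  rw [pureState, Matrix.mul_vecMulVec, Matrix.trace_vecMulVec, dotProduct_comm]

theorem trace_mul_nonneg {A B : Matrix m m ℂ} (hA : A.PosSemidef) (hB : B.PosSemidef) :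
    0 ≤ (A * B).trace := by
  obtain ⟨k, v, rfl⟩ := exists_sum_pureState hB
  rw [Matrix.mul_sum, Matrix.trace_sum]
  refine Finset.sum_nonneg fun i _ => ?_
  rw [trace_mul_pureState]
  exact hA.dotProduct_mulVec_nonneg _

theorem re_trace_mul_nonneg {A B : Matrix m m ℂ} (hA : A.PosSemidef) (hB : B.PosSemidef) :
    0 ≤ (A * B).trace.re :=
  (Complex.le_def.1 (trace_mul_nonneg hA hB)).1

theorem trace_pureState (v : m → ℂ) : (pureState v).trace = ((∑ i, ‖v i‖ ^ 2 : ℝ) : ℂ) := by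
  simp only [pureState, trace, diag_apply, vecMulVec_apply, Pi.star_apply, Complex.ofReal_sum]
  refine Finset.sum_congr rfl fun i _ => ?_
  rw [RCLike.star_def, Complex.mul_conj, Complex.normSq_eq_norm_sq]

/-- Over `ℂ`, a real-valued quadratic form already forces hermiticity, so this need not be assumed.
-/
theorem posSemidef_of_trace_mul_pureState_nonneg [DecidableEq m] {A : Matrix m m ℂ}
    (h : ∀ v, 0 ≤ (A * pureState v).trace) : A.PosSemidef := by
  rw [Matrix.posSemidef_iff_dotProduct_mulVec]
  have h' : ∀ v : m → ℂ, 0 ≤ star v ⬝ᵥ (A *ᵥ v) := fun v => by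
    rw [← trace_mul_pureState]; exact h v
  refine ⟨?_, h'⟩
  rw [← Matrix.isSymmetric_toEuclideanLin_iff, LinearMap.isSymmetric_iff_inner_map_self_real]
  intro v
  have h2 := (Complex.le_def.1 (h' v.ofLp)).2
  have h3 : inner ℂ v (toEuclideanLin A v) = star v.ofLp ⬝ᵥ (A *ᵥ v.ofLp) := by
    rw [EuclideanSpace.inner_eq_star_dotProduct, dotProduct_comm]
    rfl
  rw [inner_conj_symm, ← inner_conj_symm (toEuclideanLin A v), h3]
  exact (Complex.conj_eq_iff_im.2 h2.symm).symm

/-- By additivity it suffices to treat rank one, where this is Cauchy–Schwarz. -/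
theorem posSemidef_trace_smul_one_sub [DecidableEq m] {A : Matrix m m ℂ} (hA : A.PosSemidef) :
    (A.trace • (1 : Matrix m m ℂ) - A).PosSemidef := by
  obtain ⟨k, v, rfl⟩ := exists_sum_pureState hA
  rw [Matrix.trace_sum, Finset.sum_smul, ← Finset.sum_sub_distrib]
  refine Matrix.posSemidef_sum _ fun i _ => ?_
  refine PosSemidef.of_dotProduct_mulVec_nonneg ?_ fun x => ?_
  · refine IsHermitian.sub ?_ (posSemidef_pureState _).1
    rw [trace_pureState]
    simp [IsHermitian, conjTranspose_smul]
  · rw [sub_mulVec, smul_mulVec, one_mulVec, dotProduct_sub, dotProduct_smul, trace_pureState,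
      pureState, vecMulVec_mulVec]
    have h1 : star x ⬝ᵥ x = ((∑ j, ‖x j‖ ^ 2 : ℝ) : ℂ) := by
      simp [dotProduct, Complex.conj_mul']
    have h2 : star x ⬝ᵥ (MulOpposite.op (star (v i) ⬝ᵥ x) • v i)
        = ((‖∑ j, v i j * star (x j)‖ ^ 2 : ℝ) : ℂ) := by
      rw [dotProduct_smul, MulOpposite.smul_eq_mul_unop, MulOpposite.unop_op,
        Complex.ofReal_pow, ← Complex.mul_conj']
      simp [dotProduct, mul_comm]
    rw [h1, h2, smul_eq_mul, ← Complex.ofReal_mul, ← Complex.ofReal_sub, Complex.zero_le_real]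
    rw [sub_nonneg]
    calc ‖∑ j, v i j * star (x j)‖ ^ 2 ≤ (∑ j, ‖v i j‖ * ‖x j‖) ^ 2 := by
          gcongr
          refine (norm_sum_le _ _).trans_eq ?_
          simp
      _ ≤ _ := Finset.sum_mul_sq_le_sq_mul_sq _ _ _

/-- Singular value decomposition. -/
theorem exists_svd [DecidableEq l] [DecidableEq m] (X : Matrix l m ℂ) :
    ∃ (V : Matrix l m ℂ) (U : Matrix m m ℂ) (s : m → ℂ),
      (∀ i, s i = (Real.sqrt ((isHermitian_conjTranspose_mul_self X).eigenvalues i) : ℝ)) ∧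
      Uᴴ * U = 1 ∧ U * Uᴴ = 1 ∧ X = V * diagonal s * Uᴴ ∧ Vᴴ * V * diagonal s = diagonal s ∧
      (1 - V * Vᴴ).PosSemidef ∧ (1 - Vᴴ * V).PosSemidef := by
  set hX := isHermitian_conjTranspose_mul_self X
  set U : Matrix m m ℂ := (hX.eigenvectorUnitary : Matrix m m ℂ)
  set s : m → ℂ := fun i => (Real.sqrt (hX.eigenvalues i) : ℝ)
  have hU : Uᴴ * U = 1 := Unitary.coe_star_mul_self _
  have hU' : U * Uᴴ = 1 := Unitary.coe_mul_star_self _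
  set Y := X * U
  have hY : Yᴴ * Y = diagonal (fun i => s i * s i) := by
    have h := hX.conjStarAlgAut_star_eigenvectorUnitary
    rw [Unitary.conjStarAlgAut_star_apply] at h
    have h2 : Yᴴ * Y = Uᴴ * (Xᴴ * X) * U := by
      simp only [Y, conjTranspose_mul, Matrix.mul_assoc]
    rw [h2]
    refine h.trans ?_
    congr 1
    ext i
    simp only [s, Function.comp_apply, ← Complex.ofReal_mul]
    rw [Real.mul_self_sqrt (eigenvalues_conjTranspose_mul_self_nonneg X i)]
    rfl
  have hss : ∀ i, star (s i) = s i := fun i => Complex.conj_ofReal _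
  have hYE : Y * diagonal (fun i => (s i)⁻¹ * s i) = Y := by
    have h0 : Y * (1 - diagonal (fun i => (s i)⁻¹ * s i)) = 0 := by
      rw [← Matrix.conjTranspose_mul_self_eq_zero, conjTranspose_mul, Matrix.mul_assoc,
        ← Matrix.mul_assoc Yᴴ, hY, ← diagonal_one, diagonal_sub, diagonal_conjTranspose,
        diagonal_mul_diagonal, diagonal_mul_diagonal, ← diagonal_zero]
      congr 1
      ext i
      by_cases h : s i = 0 <;> simp [h]
    rw [Matrix.mul_sub, Matrix.mul_one, sub_eq_zero] at h0
    exact h0.symm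
  -- Since `0⁻¹ = 0`, the columns of `V` at zero singular values vanish: `V` is only a partial
  -- isometry, and `Vᴴ * V` projects onto the support of `s`.
  set V := Y * diagonal (fun i => (s i)⁻¹)
  have hVV : Vᴴ * V = diagonal (fun i => (s i)⁻¹ * s i) := by
    simp only [V]
    rw [conjTranspose_mul, Matrix.mul_assoc, ← Matrix.mul_assoc Yᴴ, hY, diagonal_conjTranspose,
      diagonal_mul_diagonal, diagonal_mul_diagonal]
    congr 1
    ext i
    simp only [Pi.star_apply, star_inv₀, hss]
    by_cases h : s i = 0 <;> simp [h]
  have hVs : V * diagonal s = Y := by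
    simp only [V]
    rw [Matrix.mul_assoc, diagonal_mul_diagonal, hYE]
  have hVE : V * (Vᴴ * V) = V := by
    rw [hVV]
    simp only [V]
    rw [Matrix.mul_assoc, diagonal_mul_diagonal]
    congr 2
    ext i
    by_cases h : s i = 0 <;> simp [h]
  refine ⟨V, U, s, fun i => rfl, hU, hU', ?_, ?_, ?_, ?_⟩
  · rw [hVs, Matrix.mul_assoc, hU', Matrix.mul_one]
  · rw [hVV, diagonal_mul_diagonal]
    congr 1
    ext i
    by_cases h : s i = 0 <;> simp [h]
  · have : (1 - V * Vᴴ) = (1 - V * Vᴴ)ᴴ * (1 - V * Vᴴ) := by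
      have h1 : V * Vᴴ * (V * Vᴴ) = V * Vᴴ := by
        rw [← Matrix.mul_assoc, Matrix.mul_assoc V, hVE]
      simp only [conjTranspose_sub, conjTranspose_one, conjTranspose_mul,
        conjTranspose_conjTranspose, sub_mul, mul_sub, h1, one_mul, mul_one, sub_self, sub_zero]
    rw [this]
    exact posSemidef_conjTranspose_mul_self _
  · have : (1 - Vᴴ * V) = (1 - Vᴴ * V)ᴴ * (1 - Vᴴ * V) := by
      have h1 : Vᴴ * V * (Vᴴ * V) = Vᴴ * V := by
        rw [Matrix.mul_assoc, hVE]
      simp only [conjTranspose_sub, conjTranspose_one, conjTranspose_mul,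
        conjTranspose_conjTranspose, sub_mul, mul_sub, h1, one_mul, mul_one, sub_self, sub_zero]
    rw [this]
    exact posSemidef_conjTranspose_mul_self _

/-- Two matrices on top of each other. -/
def stack (W : Bool → Matrix m n ℂ) : Matrix (m × Bool) n ℂ := of fun p j => W p.2 p.1 j

/-- The block `(x, y)` of a two by two block matrix. -/
def block (Z : Matrix (m × Bool) (m × Bool) ℂ) (x y : Bool) : Matrix m m ℂ :=
  Z.submatrix (fun i => (i, x)) (fun i => (i, y))

theorem stack_conj (Z : Matrix (m × Bool) (m × Bool) ℂ) (W : Bool → Matrix m n ℂ) :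
    (stack W)ᴴ * Z * stack W = ∑ x, ∑ y, (W x)ᴴ * block Z x y * W y := by
  ext i j
  simp only [Matrix.sum_apply, mul_apply, stack, block, conjTranspose_apply, of_apply,
    submatrix_apply, Fintype.sum_prod_type]
  simp only [Fintype.sum_bool, Finset.sum_mul, add_mul, Finset.sum_add_distrib]
  ring

theorem trace_block (Z : Matrix (m × Bool) (m × Bool) ℂ) :
    Z.trace = (block Z false false).trace + (block Z true true).trace := by
  simp only [trace, block, diag_apply, submatrix_apply, Fintype.sum_prod_type, Fintype.sum_bool,
    Finset.sum_add_distrib, add_comm]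

theorem block_conjTranspose {Z : Matrix (m × Bool) (m × Bool) ℂ} (hZ : Z.PosSemidef) :
    block Z true false = (block Z false true)ᴴ := by
  ext i j
  simp only [block, conjTranspose_apply, submatrix_apply]
  exact (hZ.1.apply _ _).symm

theorem posSemidef_block {Z : Matrix (m × Bool) (m × Bool) ℂ} (hZ : Z.PosSemidef) (x : Bool) :
    (block Z x x).PosSemidef :=
  hZ.submatrix _

/-- The trace norm of an off-diagonal block of a positive matrix. -/
theorem traceNorm_block_le [DecidableEq m] {Z : Matrix (m × Bool) (m × Bool) ℂ}
    (hZ : Z.PosSemidef) : 2 * traceNorm (block Z false true) ≤ Z.trace.re := by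
  set X := block Z false true with hXdef
  obtain ⟨V, U, s, hs, hU, hU', hX, hVs, hV, -⟩ := exists_svd X
  have h1 : (traceNorm X : ℂ) = (Vᴴ * X * U).trace := by
    have : Vᴴ * X * U = diagonal s := by
      rw [hX, Matrix.mul_assoc, Matrix.mul_assoc, Matrix.mul_assoc, hU, mul_one,
        ← Matrix.mul_assoc, hVs]
    rw [this, trace_diagonal, traceNorm, Complex.ofReal_sum]
    exact Finset.sum_congr rfl fun i _ => (hs i).symm
  -- Compressing `Z` to the columns `(V, -U)` turns the cross terms into `-2 ‖X‖₁`, while the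
  -- diagonal blocks contribute at most their traces, as `U` is unitary and `V` a contraction.
  have h2 := re_trace_nonneg (hZ.conjTranspose_mul_mul_same (stack fun x => cond x (-U) V))
  rw [stack_conj] at h2
  simp only [Fintype.sum_bool, cond_true, cond_false, block_conjTranspose hZ, conjTranspose_neg,
    ← hXdef, trace_add, Complex.add_re, Matrix.neg_mul, Matrix.mul_neg, neg_neg, trace_neg,
    Complex.neg_re] at h2
  have h3 : (Uᴴ * Xᴴ * V).trace.re = traceNorm X := by
    have : Uᴴ * Xᴴ * V = (Vᴴ * X * U)ᴴ := by
      simp only [conjTranspose_mul, conjTranspose_conjTranspose, Matrix.mul_assoc]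
    rw [this, trace_conjTranspose, ← h1]
    simp
  have h4 : (Uᴴ * block Z true true * U).trace = (block Z true true).trace := by
    rw [trace_mul_cycle, hU', one_mul]
  have h5 : (Vᴴ * block Z false false * V).trace.re ≤ (block Z false false).trace.re := by
    rw [trace_mul_cycle]
    have := re_trace_mul_nonneg hV (posSemidef_block hZ false)
    rw [sub_mul, one_mul, trace_sub, Complex.sub_re] at this
    linarith
  rw [h3, h4, ← h1, Complex.ofReal_re] at h2
  rw [trace_block, Complex.add_re]
  linarith

/-- Take the blocks `V s Vᴴ`, `X`, `Xᴴ`, `U s Uᴴ` from `X = V s Uᴴ`. With `traceNorm_block_le` this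
makes `2 ‖X‖₁` the least trace of a positive matrix with off-diagonal block `X`, so trace norm
estimates reduce to positivity. -/
theorem exists_posSemidef_block [DecidableEq m] (X : Matrix m m ℂ) :
    ∃ Z : Matrix (m × Bool) (m × Bool) ℂ, Z.PosSemidef ∧ block Z false true = X ∧
      Z.trace.re = 2 * traceNorm X := by
  obtain ⟨V, U, s, hs, hU, hU', hX, hVs, -, -⟩ := exists_svd X
  set W := stack fun x => cond x U V
  have htr : (diagonal s).trace.re = traceNorm X := by
    rw [trace_diagonal, traceNorm, Complex.re_sum]
    exact Finset.sum_congr rfl fun i _ => by rw [hs]; simp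
  have hb : ∀ x y, block (W * diagonal s * Wᴴ) x y = cond x U V * diagonal s * (cond y U V)ᴴ := by
    intro x y
    ext i j
    simp only [block, W, stack, mul_apply, submatrix_apply, of_apply, conjTranspose_apply]
  refine ⟨W * diagonal s * Wᴴ, ?_, ?_, ?_⟩
  · refine PosSemidef.mul_mul_conjTranspose_same (PosSemidef.diagonal fun i => ?_) W
    rw [hs, Pi.zero_apply, Complex.zero_le_real]
    exact Real.sqrt_nonneg _
  · rw [hb, hX]; rfl
  · rw [trace_block, hb, hb]
    simp only [cond_true, cond_false]
    rw [trace_mul_cycle, hVs, trace_mul_cycle, hU, one_mul, Complex.add_re, htr]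
    ring

theorem traceNorm_of_posSemidef_le [DecidableEq m] {A : Matrix m m ℂ} (hA : A.PosSemidef) :
    traceNorm A ≤ A.trace.re := by
  -- All four blocks of this positive matrix equal `A`.
  have h := traceNorm_block_le (Z := A.submatrix Prod.fst Prod.fst) (hA.submatrix _)
  rw [trace_block, Complex.add_re] at h
  change 2 * traceNorm A ≤ A.trace.re + A.trace.re at h
  linarith

/-- A test distinguishes no better than the trace norm. -/
theorem neg_traceNorm_le_re_trace_mul [DecidableEq m] {P : Matrix m m ℂ} (hP : P.PosSemidef)
    (hP' : (1 - P).PosSemidef) (X : Matrix m m ℂ) : -traceNorm X ≤ (P * X).trace.re := by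
  obtain ⟨Z, hZ, rfl, htr⟩ := exists_posSemidef_block X
  -- Pairing `Z` with the matrix all of whose blocks are `P` gives twice `Re tr (P X)` plus diagonal
  -- terms, which are at most `tr Z = 2 ‖X‖₁`.
  have h1 := re_trace_mul_nonneg (hP.submatrix (Prod.fst : m × Bool → m)) hZ
  have h2 : (P.submatrix (Prod.fst : m × Bool → m) Prod.fst * Z).trace =
      ∑ x, ∑ y, (P * block Z x y).trace := by
    simp only [trace, diag_apply, mul_apply, submatrix_apply, block, Fintype.sum_prod_type,
      Fintype.sum_bool, Finset.sum_add_distrib]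
    ring
  have h3 : (P * block Z true false).trace.re = (P * block Z false true).trace.re := by
    rw [block_conjTranspose hZ, ← Complex.conj_re, ← RCLike.star_def, ← trace_conjTranspose,
      conjTranspose_mul, conjTranspose_conjTranspose, hP.1.eq, trace_mul_comm]
  have h4 : ∀ x, (P * block Z x x).trace.re ≤ (block Z x x).trace.re := fun x => by
    have := re_trace_mul_nonneg hP' (posSemidef_block hZ x)
    rw [sub_mul, one_mul, trace_sub, Complex.sub_re] at this
    linarith
  rw [h2] at h1
  simp only [Fintype.sum_bool, Complex.add_re, h3] at h1
  rw [trace_block, Complex.add_re] at htr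
  linarith [h4 true, h4 false]

end LinearAlgebra

/-! ### Completely positive maps, separable channels and the diamond norm. -/

section Maps

variable {k l m n r s : Type*}

/-- The linear map `T ⊗ id_r`. -/
def applyLeftLin (r : Type*) (T : OpMap m n) : OpMap (m × r) (n × r) where
  toFun X := applyLeft T X
  map_add' X Y := by
    ext p q
    exact congrFun (congrFun (T.map_add (of fun k l => X (k, p.2) (l, q.2))
      (of fun k l => Y (k, p.2) (l, q.2))) p.1) q.1
  map_smul' c X := by
    ext p q
    exact congrFun (congrFun (T.map_smul c (of fun k l => X (k, p.2) (l, q.2))) p.1) q.1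

theorem applyLeft_sub (T : OpMap m n) (X Y : Matrix (m × r) (m × r) ℂ) :
    applyLeft T (X - Y) = applyLeft T X - applyLeft T Y := (applyLeftLin r T).map_sub X Y

theorem applyLeft_smul (T : OpMap m n) (c : ℂ) (X : Matrix (m × r) (m × r) ℂ) :
    applyLeft T (c • X) = c • applyLeft T X := (applyLeftLin r T).map_smul c X

theorem applyLeft_sum {ι : Type*} (T : OpMap m n) (u : Finset ι)
    (X : ι → Matrix (m × r) (m × r) ℂ) :
    applyLeft T (∑ i ∈ u, X i) = ∑ i ∈ u, applyLeft T (X i) :=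
  map_sum (applyLeftLin r T) X u

theorem applyLeft_submatrix (T : OpMap m n) (X : Matrix (m × r) (m × r) ℂ) (f : s → r) :
    applyLeft T (X.submatrix (Prod.map id f) (Prod.map id f)) =
      (applyLeft T X).submatrix (Prod.map id f) (Prod.map id f) := rfl

theorem IsCompletelyPositive.posSemidef [Finite r] {T : OpMap m n} (hT : IsCompletelyPositive T)
    {X : Matrix (m × r) (m × r) ℂ} (hX : X.PosSemidef) : (applyLeft T X).PosSemidef := by
  obtain ⟨k, ⟨e⟩⟩ := Finite.exists_equiv_fin r
  have h := hT k _ (hX.submatrix (Prod.map id e.symm))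
  rw [applyLeft_submatrix] at h
  have h2 := h.submatrix (Prod.map id e : n × r → n × Fin k)
  rw [submatrix_submatrix] at h2
  convert! h2
  ext p q
  obtain ⟨a, b⟩ := p
  obtain ⟨c, d⟩ := q
  simp only [submatrix_apply, Function.comp_apply, Prod.map_apply, id_eq, Equiv.symm_apply_apply]

theorem IsCompletelyPositive.posSemidef_apply {T : OpMap m n} (hT : IsCompletelyPositive T)
    {X : Matrix m m ℂ} (hX : X.PosSemidef) : (T X).PosSemidef := by
  have h := hT.posSemidef (r := Unit) (hX.submatrix (Prod.fst : m × Unit → m))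
  exact h.submatrix (fun i => (i, ()))

theorem IsCompletelyPositive.comp {S : OpMap n k} {T : OpMap m n} (hS : IsCompletelyPositive S)
    (hT : IsCompletelyPositive T) : IsCompletelyPositive (S ∘ₗ T) :=
  fun r X hX => hS r _ (hT r X hX)

theorem IsCompletelyPositive.add {S T : OpMap m n} (hS : IsCompletelyPositive S)
    (hT : IsCompletelyPositive T) : IsCompletelyPositive (S + T) :=
  fun r X hX => (hS r X hX).add (hT r X hX)

theorem trace_applyLeft [Fintype m] [Fintype n] [Fintype r] {T : OpMap m n}
    (hT : IsTracePreserving T) (X : Matrix (m × r) (m × r) ℂ) :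
    (applyLeft T X).trace = X.trace := by
  simp only [trace, diag_apply, Fintype.sum_prod_type_right]
  exact Finset.sum_congr rfl fun a _ => hT (of fun k l => X (k, a) (l, a))

theorem applyLeft_kraus [Fintype m] [Fintype n] [Fintype r] [DecidableEq r] {ι : Type*}
    [Fintype ι] {T : OpMap m n} {K : ι → Matrix n m ℂ} (hT : ∀ X, T X = ∑ i, K i * X * (K i)ᴴ)
    (X : Matrix (m × r) (m × r) ℂ) :
    applyLeft T X =
      ∑ i, (K i ⊗ₖ (1 : Matrix r r ℂ)) * X * (K i ⊗ₖ (1 : Matrix r r ℂ))ᴴ := by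
  ext ⟨p, a⟩ ⟨q, b⟩
  simp only [applyLeft, hT, of_apply, Matrix.sum_apply, mul_apply, conjTranspose_apply,
    kroneckerMap_apply, Fintype.sum_prod_type, one_apply, mul_ite, mul_one, mul_zero, ite_mul,
    zero_mul, apply_ite star, star_zero, Finset.sum_ite_eq,
    Finset.mem_univ, if_true]

theorem isCompletelyPositive_of_kraus [Fintype m] [Fintype n] {ι : Type*}
    [Fintype ι] {T : OpMap m n} {K : ι → Matrix n m ℂ} (hT : ∀ X, T X = ∑ i, K i * X * (K i)ᴴ) :
    IsCompletelyPositive T := by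
  intro r X hX
  rw [applyLeft_kraus hT]
  exact posSemidef_sum _ fun i _ => hX.mul_mul_conjTranspose_same _

theorem IsSeparableChannel.isChannel {A₀ B₀ A₁ B₁ : Type*} [Fintype A₀] [Fintype B₀] [Fintype A₁]
    [Fintype B₁] {M : OpMap (A₀ × B₀) (A₁ × B₁)} (hM : IsSeparableChannel M) : IsChannel M :=
  let ⟨h, _, _, _, hk⟩ := hM
  ⟨isCompletelyPositive_of_kraus hk, h⟩

/-- Product Kraus operators may be indexed by any finite type. -/
theorem isSeparableChannel_of_kraus {A₀ B₀ A₁ B₁ ι : Type*} [Fintype A₀] [Fintype B₀] [Fintype A₁]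
    [Fintype B₁] [Fintype ι] {M : OpMap (A₀ × B₀) (A₁ × B₁)} (h : IsTracePreserving M)
    (S : ι → Matrix A₁ A₀ ℂ) (T : ι → Matrix B₁ B₀ ℂ)
    (hM : ∀ X, M X = ∑ i, (S i ⊗ₖ T i) * X * (S i ⊗ₖ T i)ᴴ) : IsSeparableChannel M := by
  refine ⟨h, Fintype.card ι, S ∘ (Fintype.equivFin ι).symm, T ∘ (Fintype.equivFin ι).symm,
    fun X => ?_⟩
  rw [hM]
  exact ((Fintype.equivFin ι).symm.sum_comp
    (fun i => (S i ⊗ₖ T i) * X * (S i ⊗ₖ T i)ᴴ)).symm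

theorem IsSeparableChannel.convex {A₀ B₀ A₁ B₁ : Type*} [Fintype A₀] [Fintype B₀] [Fintype A₁]
    [Fintype B₁] {M M' : OpMap (A₀ × B₀) (A₁ × B₁)} (hM : IsSeparableChannel M)
    (hM' : IsSeparableChannel M') {t : ℝ} (h0 : 0 ≤ t) (h1 : t ≤ 1) :
    IsSeparableChannel ((t : ℂ) • M + ((1 - t : ℝ) : ℂ) • M') := by
  obtain ⟨hM, k, S, T, hk⟩ := hM
  obtain ⟨hM', k', S', T', hk'⟩ := hM'
  have hsq : ∀ c : ℝ, 0 ≤ c → ∀ (S : Matrix A₁ A₀ ℂ) (T : Matrix B₁ B₀ ℂ)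
      (X : Matrix (A₀ × B₀) (A₀ × B₀) ℂ),
      ((((Real.sqrt c : ℝ) : ℂ) • S) ⊗ₖ T) * X * ((((Real.sqrt c : ℝ) : ℂ) • S) ⊗ₖ T)ᴴ =
        (c : ℂ) • ((S ⊗ₖ T) * X * (S ⊗ₖ T)ᴴ) := by
    intro c hc S T X
    rw [smul_kronecker, conjTranspose_smul, Matrix.smul_mul, Matrix.smul_mul, Matrix.mul_smul,
      smul_smul, RCLike.star_def, Complex.conj_ofReal, ← Complex.ofReal_mul, Real.mul_self_sqrt hc]
  refine isSeparableChannel_of_kraus (ι := Fin k ⊕ Fin k') (fun X => ?_)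
    (Sum.elim (fun i => ((Real.sqrt t : ℝ) : ℂ) • S i)
      (fun i => ((Real.sqrt (1 - t) : ℝ) : ℂ) • S' i))
    (Sum.elim T T') (fun X => ?_)
  · simp only [LinearMap.add_apply, LinearMap.smul_apply, trace_add, trace_smul, hM X, hM' X,
      smul_eq_mul, ← add_mul, ← Complex.ofReal_add]
    simp
  · simp only [Fintype.sum_sum_type, Sum.elim_inl, Sum.elim_inr, hsq t h0,
      hsq (1 - t) (sub_nonneg.2 h1), LinearMap.add_apply, LinearMap.smul_apply, hk, hk',
      Finset.smul_sum]

/-- Scaled differences of channels have bounded trace norm. -/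
theorem traceNorm_applyLeft_sub_le [Fintype m] [DecidableEq m] [Fintype n] [DecidableEq n]
    [Fintype r] [DecidableEq r] {S T : OpMap m n} (hS : IsChannel S) (hT : IsChannel T) {c : ℝ}
    (hc : 0 ≤ c) (X : Matrix (m × r) (m × r) ℂ) :
    traceNorm (applyLeft ((c : ℂ) • (S - T)) X) ≤ 2 * c * traceNorm X := by
  obtain ⟨Z, hZ, hX, htr⟩ := exists_posSemidef_block X
  -- The block index is absorbed into the reference, so complete positivity applies to the dilation
  -- `Z` of `X`.
  set Z₁ : Matrix (m × (r × Bool)) (m × (r × Bool)) ℂ :=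
    Z.submatrix (fun p => ((p.1, p.2.1), p.2.2)) (fun p => ((p.1, p.2.1), p.2.2))
  have hZ₁ : Z₁.PosSemidef := hZ.submatrix _
  have hZ₁tr : Z₁.trace = Z.trace := by
    simp only [trace, diag_apply, Z₁, submatrix_apply, Fintype.sum_prod_type]
  set f : (n × r) × Bool → n × (r × Bool) := fun p => (p.1.1, (p.1.2, p.2))
  -- Conjugation by `D` flips the sign of the off-diagonal blocks only: the positive matrix `ZS + D
  -- * ZT * Dᴴ` has `S(X) - T(X)` off the diagonal, while the traces add.
  set D : Matrix ((n × r) × Bool) ((n × r) × Bool) ℂ := diagonal fun p => cond p.2 1 (-1)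
  have htrf : ∀ A : Matrix (n × (r × Bool)) (n × (r × Bool)) ℂ,
      (A.submatrix f f).trace = A.trace := fun A => by
    simp only [trace, diag_apply, f, submatrix_apply, Fintype.sum_prod_type]
  set ZS := (applyLeft S Z₁).submatrix f f
  set ZT := (applyLeft T Z₁).submatrix f f
  have hZS : ZS.PosSemidef := (hS.1.posSemidef hZ₁).submatrix f
  have hZT : ZT.PosSemidef := (hT.1.posSemidef hZ₁).submatrix f
  have hW : ((c : ℂ) • (ZS + D * ZT * Dᴴ)).PosSemidef :=
    (hZS.add (hZT.mul_mul_conjTranspose_same D)).smul (Complex.zero_le_real.2 hc)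
  have hb : block ((c : ℂ) • (ZS + D * ZT * Dᴴ)) false true =
      applyLeft ((c : ℂ) • (S - T)) X := by
    ext p q
    have h1 : block ZS false true = applyLeft S X := by rw [← hX]; rfl
    have h2 : block ZT false true = applyLeft T X := by rw [← hX]; rfl
    have h3 : (D * ZT * Dᴴ) (p, false) (q, true) = -block ZT false true p q := by
      simp only [D, diagonal_conjTranspose, mul_diagonal, diagonal_mul, Pi.star_apply, cond_true,
        cond_false, star_one, mul_one, neg_mul, one_mul]
      rfl
    change (c : ℂ) • (block ZS false true p q + (D * ZT * Dᴴ) (p, false) (q, true)) = _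
    rw [h3, h1, h2, ← sub_eq_add_neg]
    rfl
  have hD : Dᴴ * D = 1 := by
    simp only [D, diagonal_conjTranspose, diagonal_mul_diagonal, Pi.star_apply]
    rw [← diagonal_one]
    congr 1
    ext ⟨p, x⟩
    cases x <;> simp
  have := traceNorm_block_le hW
  rw [hb, trace_smul, trace_add, trace_mul_cycle, hD, one_mul, htrf, htrf, trace_applyLeft hS.2,
    trace_applyLeft hT.2, hZ₁tr, smul_eq_mul, Complex.re_ofReal_mul, Complex.add_re, htr] at this
  linarith

/-- Half the diamond distance between a channel and a mixture with weight `1 - c` on it. -/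
theorem diamondNorm_smul_sub_le [Fintype m] [DecidableEq m] [Fintype n] [DecidableEq n]
    {S T : OpMap m n} (hS : IsChannel S) (hT : IsChannel T) {c : ℝ} (hc : 0 ≤ c) :
    2⁻¹ * diamondNorm ((c : ℂ) • (S - T)) ≤ ENNReal.ofReal c := by
  have h : diamondNorm ((c : ℂ) • (S - T)) ≤ ENNReal.ofReal (2 * c) := by
    refine iSup_le fun r => iSup_le fun X => iSup_le fun hX => ENNReal.ofReal_le_ofReal ?_
    refine (traceNorm_applyLeft_sub_le hS hT hc X).trans ?_
    nlinarith
  calc _ ≤ 2⁻¹ * ENNReal.ofReal (2 * c) := by gcongr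
    _ = ENNReal.ofReal c := by
      rw [ENNReal.ofReal_mul zero_le_two, ← mul_assoc, ENNReal.ofReal_ofNat,
        ENNReal.inv_mul_cancel two_ne_zero ENNReal.ofNat_ne_top, one_mul]

end Maps

/-! ### Separable mixtures containing the swap channel. -/

section Swap

variable {K : ℕ}

theorem swapChannel_apply (X : Matrix (Fin K × Fin K) (Fin K × Fin K) ℂ) (p q) :
    swapChannel K X p q = X p.swap q.swap := by
  have h1 : ∀ p q : Fin K × Fin K, (p = q.swap) = (q = p.swap) := fun p q => by
    rw [eq_iff_iff]; constructor <;> (rintro rfl; rw [Prod.swap_swap])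
  change (swapGate K * X * (swapGate K)ᴴ) p q = _
  simp only [mul_apply, swapGate, of_apply, conjTranspose_apply, ite_mul, one_mul, zero_mul,
    apply_ite star, star_one, star_zero, mul_ite, mul_one, mul_zero, h1 _ (_ : Fin K × Fin K),
    Finset.sum_ite_eq', Finset.mem_univ, if_true]

theorem isChannel_swapChannel : IsChannel (swapChannel K) := by
  refine ⟨isCompletelyPositive_of_kraus (ι := Unit) (K := fun _ => swapGate K) fun X => ?_,
    fun X => ?_⟩
  · simp [swapChannel]
  · simp only [trace, diag_apply, swapChannel_apply]
    exact (Equiv.prodComm (Fin K) (Fin K)).sum_comp (fun p => X p p)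

/-- The channel measuring in the computational basis and preparing a uniformly random basis state
different from the swapped one. -/
noncomputable def wrongSwap (K : ℕ) : OpMap (Fin K × Fin K) (Fin K × Fin K) where
  toFun X := diagonal fun p => ((K : ℂ) ^ 2 - 1)⁻¹ * (X.trace - X p.swap p.swap)
  map_add' X Y := by
    rw [diagonal_add]; congr 1; ext p; simp only [trace_add, Matrix.add_apply]; ring
  map_smul' c X := by
    rw [RingHom.id_apply, ← diagonal_smul]; congr 1; ext p
    simp only [trace_smul, Matrix.smul_apply, Pi.smul_apply, smul_eq_mul]; ring

theorem one_lt_sq_of_two_le (hK : 2 ≤ K) : (1 : ℝ) < (K : ℝ) ^ 2 := by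
  have : (2 : ℝ) ≤ K := by exact_mod_cast hK
  nlinarith

/-- The Kraus operators are multiples of `|p⟩⟨q|` with `q ≠ p.swap`, which are products of matrix
units. The normalization `K² - 1` is nonzero because `2 ≤ K`. -/
theorem isSeparableChannel_wrongSwap (hK : 2 ≤ K) : IsSeparableChannel (wrongSwap K) := by
  have hK1 := one_lt_sq_of_two_le hK
  have hK0 : ((K : ℂ) ^ 2 - 1) ≠ 0 := by
    have : ((K : ℝ) ^ 2 - 1 : ℝ) ≠ 0 := by linarith
    exact_mod_cast this
  set c : ℂ := ((Real.sqrt ((K : ℝ) ^ 2 - 1)⁻¹ : ℝ) : ℂ)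
  have hc : c * c = ((K : ℂ) ^ 2 - 1)⁻¹ := by
    rw [← Complex.ofReal_mul, Real.mul_self_sqrt (inv_nonneg.2 (by linarith))]
    push_cast
    rfl
  refine isSeparableChannel_of_kraus (ι := (Fin K × Fin K) × (Fin K × Fin K)) (fun X => ?_)
    (fun i => (if i.2 = i.1.swap then 0 else c) • Matrix.single i.1.1 i.2.1 1)
    (fun i => Matrix.single i.1.2 i.2.2 1) (fun X => ?_)
  · change (diagonal _).trace = _
    have hX : ∑ p : Fin K × Fin K, X p.swap p.swap = X.trace :=
      (Equiv.prodComm (Fin K) (Fin K)).sum_comp (fun p => X p p)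
    rw [trace_diagonal, ← Finset.mul_sum, Finset.sum_sub_distrib, hX]
    simp only [Finset.sum_const, Finset.card_univ, Fintype.card_prod, Fintype.card_fin,
      nsmul_eq_mul]
    push_cast
    field_simp
  · have h : ∀ i : (Fin K × Fin K) × (Fin K × Fin K),
        (((if i.2 = i.1.swap then 0 else c) • Matrix.single i.1.1 i.2.1 1) ⊗ₖ
          (Matrix.single i.1.2 i.2.2 1 : Matrix _ _ ℂ)) * X *
        (((if i.2 = i.1.swap then 0 else c) • Matrix.single i.1.1 i.2.1 1) ⊗ₖ
          (Matrix.single i.1.2 i.2.2 1 : Matrix _ _ ℂ))ᴴ =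
        Matrix.single i.1 i.1 (if i.2 = i.1.swap then 0 else c * c * X i.2 i.2) := by
      rintro ⟨p, q⟩
      have hcc : star c = c := Complex.conj_ofReal _
      rw [smul_kronecker, single_kronecker_single, conjTranspose_smul, Matrix.smul_mul,
        Matrix.smul_mul, Matrix.mul_smul, conjTranspose_single, Matrix.single_mul_mul_single]
      simp only [smul_single]
      congr 1
      split_ifs <;> simp [hcc]
      ring
    simp_rw [h]
    change diagonal _ = _
    rw [Fintype.sum_prod_type]
    have h2 : ∀ x : Fin K × Fin K, (∑ y, Matrix.single x x
          (if y = x.swap then 0 else c * c * X y y)) =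
        Matrix.single x x (c * c * (X.trace - X x.swap x.swap)) := by
      intro x
      have : ∀ y, (if y = x.swap then 0 else c * c * X y y) =
          c * c * X y y - if y = x.swap then c * c * X y y else 0 := fun y => by
        split_ifs <;> simp
      ext i j
      simp only [Matrix.sum_apply, single_apply, this]
      split_ifs
      · rw [Finset.sum_sub_distrib, Finset.sum_ite_eq', if_pos (Finset.mem_univ _),
          ← Finset.mul_sum, mul_sub]
        rfl
      · simp
    rw [Finset.sum_congr rfl fun x _ => h2 x]
    ext p q
    simp only [Matrix.sum_apply, single_apply, ite_and, hc, diagonal_apply,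
      Finset.sum_ite_eq', Finset.mem_univ, if_true]

/-- Independent phases, fourth roots of unity. -/
noncomputable def phase {α : Type*} (f : α → Fin 4) (x : α) : ℂ := Complex.I ^ (f x : ℕ)

theorem phase_mul_star {α : Type*} (f : α → Fin 4) (x : α) : phase f x * star (phase f x) = 1 := by
  rw [phase, star_pow, ← mul_pow]
  simp

/-- Only terms whose phases cancel against conjugate phases survive the average. Random signs would
not do: they would also keep `x = w`, `y = z`, where fourth roots of unity leave a vanishing mean
square. -/
theorem sum_phase {α : Type*} [Fintype α] [DecidableEq α] (x y z w : α) :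
    ∑ f : α → Fin 4, phase f x * star (phase f y) * star (phase f z) * phase f w =
      if (x = y ∧ z = w) ∨ (x = z ∧ y = w) then (4 : ℂ) ^ Fintype.card α else 0 := by
  split_ifs with h
  · rw [Finset.sum_congr rfl (g := fun _ => (1 : ℂ))]
    · simp
    · intro f _
      rcases h with ⟨rfl, rfl⟩ | ⟨rfl, rfl⟩
      · rw [phase_mul_star, one_mul, mul_comm, phase_mul_star]
      · linear_combination (phase f y * star (phase f y)) * phase_mul_star f x
          + phase_mul_star f y
  · set g : (α → Fin 4) → ℂ :=
      fun f => phase f x * star (phase f y) * star (phase f z) * phase f w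
    have hstep : ∀ a : α, ∃ σ : (α → Fin 4) ≃ (α → Fin 4), ∀ f b,
        phase (σ f) b = (if b = a then Complex.I else 1) * phase f b := by
      intro a
      refine ⟨Equiv.addRight (Pi.single a 1), fun f b => ?_⟩
      by_cases hb : b = a
      · subst hb
        simp only [phase, Equiv.coe_addRight, Pi.add_apply, Pi.single_eq_same, if_true]
        generalize f b = t
        fin_cases t <;> simp [pow_succ]
      · simp [phase, hb]
    -- Shifting `f` at one point `a` permutes the summation and multiplies every term by `c`; if `c
    -- ≠ 1`, the sum is zero.
    have hzero : ∀ a : α, ∀ c : ℂ, c ≠ 1 →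
        (if x = a then Complex.I else 1) * star (if y = a then Complex.I else 1) *
          star (if z = a then Complex.I else 1) * (if w = a then Complex.I else 1) = c →
        ∑ f, g f = 0 := by
      intro a c hc hca
      obtain ⟨σ, hσ⟩ := hstep a
      have h1 : ∑ f, g f = c * ∑ f, g f := by
        conv_lhs => rw [← σ.sum_comp g]
        rw [Finset.mul_sum]
        refine Finset.sum_congr rfl fun f _ => ?_
        simp only [g, hσ, star_mul']
        rw [← hca]
        ring
      by_contra h0
      exact hc (mul_right_cancel₀ h0 (by rw [one_mul]; exact h1.symm))
    have hI : Complex.I ≠ 1 := fun h => by simpa using congrArg Complex.re h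
    have hI2 : (-1 : ℂ) ≠ 1 := by norm_num
    by_cases h1 : x = y
    · have hzw : z ≠ w := fun e => h (Or.inl ⟨h1, e⟩)
      subst h1
      by_cases hx : x = w
      · subst hx
        exact hzero x Complex.I hI (by simp [hzw])
      · exact hzero w Complex.I hI (by simp [hzw, hx])
    · by_cases h2 : x = z
      · have hyw : y ≠ w := fun e => h (Or.inr ⟨h2, e⟩)
        subst h2
        by_cases hx : x = w
        · subst hx
          exact hzero x Complex.I hI (by simp [hyw])
        · exact hzero w Complex.I hI (by simp [hyw, hx])
      · by_cases hx : x = w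
        · subst hx
          exact hzero x (-1) hI2 (by simp [Ne.symm h1, Ne.symm h2])
        · exact hzero x Complex.I hI (by simp [Ne.symm h1, Ne.symm h2, Ne.symm hx])

/-- The mixture of the swap and the wrong swap at the threshold of separability. -/
theorem isSeparableChannel_threshold (hK : 2 ≤ K) :
    IsSeparableChannel (((((K : ℝ) ^ 2)⁻¹ : ℝ) : ℂ) • swapChannel K +
      ((1 - ((K : ℝ) ^ 2)⁻¹ : ℝ) : ℂ) • wrongSwap K) := by
  have hK1 := one_lt_sq_of_two_le hK
  have hK0 : ((K : ℂ) ^ 2 - 1) ≠ 0 := by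
    have : ((K : ℝ) ^ 2 - 1 : ℝ) ≠ 0 := by linarith
    exact_mod_cast this
  have hK2 : (K : ℂ) ≠ 0 := by
    have : K ≠ 0 := by omega
    exact_mod_cast this
  have htp : IsTracePreserving (((((K : ℝ) ^ 2)⁻¹ : ℝ) : ℂ) • swapChannel K +
      ((1 - ((K : ℝ) ^ 2)⁻¹ : ℝ) : ℂ) • wrongSwap K) := fun X => by
    simp only [LinearMap.add_apply, LinearMap.smul_apply, trace_add, trace_smul, smul_eq_mul,
      isChannel_swapChannel.2 X, (isSeparableChannel_wrongSwap hK).1 X, ← add_mul,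
      ← Complex.ofReal_add]
    simp
  -- At weight `K⁻²` the terms `X p.swap p.swap` cancel on the diagonal, since `(1 - K⁻²) / (K² - 1)
  -- = K⁻²`.
  have hval : ∀ X p q, ((((((K : ℝ) ^ 2)⁻¹ : ℝ) : ℂ) • swapChannel K +
      ((1 - ((K : ℝ) ^ 2)⁻¹ : ℝ) : ℂ) • wrongSwap K) X) p q =
        ((K : ℂ) ^ 2)⁻¹ * if p = q then X.trace else X p.swap q.swap := by
    intro X p q
    have h : wrongSwap K X p q =
        if p = q then ((K : ℂ) ^ 2 - 1)⁻¹ * (X.trace - X p.swap p.swap) else 0 :=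
      diagonal_apply ..
    simp only [LinearMap.add_apply, LinearMap.smul_apply, Matrix.add_apply, Matrix.smul_apply,
      smul_eq_mul, swapChannel_apply, h]
    split_ifs with hpq
    · subst hpq
      push_cast
      field_simp
      ring
    · push_cast
      ring
  set d := Fintype.card (Fin K × Fin K)
  set c : ℂ := ((Real.sqrt (((4 : ℝ) ^ d)⁻¹ * ((K : ℝ) ^ 2)⁻¹) : ℝ) : ℂ)
  have hcc : star c = c := Complex.conj_ofReal _
  have hc : c * c * (4 : ℂ) ^ d = ((K : ℂ) ^ 2)⁻¹ := by
    rw [← Complex.ofReal_mul, Real.mul_self_sqrt (by positivity)]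
    push_cast
    field_simp
  -- Up to scalars, the second factor is the adjoint of the first. Of the two pairings in
  -- `sum_phase`, one forces `k = p.swap`, `l = q.swap` (the swap), the other `k = l`, `p = q` (the
  -- trace on the diagonal).
  refine isSeparableChannel_of_kraus htp (ι := Fin K × Fin K → Fin 4)
    (fun f => of fun a₁ a₀ => c * phase f (a₀, a₁))
    (fun f => of fun b₁ b₀ => star (phase f (b₁, b₀)))
    fun X => ?_
  ext p q
  rw [hval]
  simp only [Matrix.sum_apply, mul_apply, kroneckerMap_apply, of_apply, conjTranspose_apply,
    star_mul', star_star, hcc, Finset.sum_mul]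
  rw [Finset.sum_comm]
  have h1 : ∀ l : Fin K × Fin K, ∑ f : Fin K × Fin K → Fin 4, ∑ k : Fin K × Fin K,
      c * phase f (k.1, p.1) * star (phase f (p.2, k.2)) * X k l *
        (c * star (phase f (l.1, q.1)) * phase f (q.2, l.2)) =
      ∑ k : Fin K × Fin K,
        if p = q then (if k = l then ((K : ℂ) ^ 2)⁻¹ * X k k else 0)
        else (if k = p.swap then if l = q.swap then ((K : ℂ) ^ 2)⁻¹ * X p.swap q.swap else 0
          else 0) := by
    intro l
    rw [Finset.sum_comm]
    refine Finset.sum_congr rfl fun k _ => ?_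
    rw [Finset.sum_congr rfl (g := fun f => c * c * X k l * (phase f (k.1, p.1) *
      star (phase f (p.2, k.2)) * star (phase f (l.1, q.1)) * phase f (q.2, l.2)))
      fun f _ => by ring, ← Finset.mul_sum, sum_phase]
    change _ * (if _ then (4 : ℂ) ^ d else 0) = _
    rw [← hc]
    obtain ⟨k₁, k₂⟩ := k
    obtain ⟨l₁, l₂⟩ := l
    obtain ⟨p₁, p₂⟩ := p
    obtain ⟨q₁, q₂⟩ := q
    simp only [Prod.mk.injEq, Prod.swap_prod_mk]
    split_ifs <;> grind
  rw [Finset.sum_congr rfl fun l _ => h1 l]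
  split_ifs with hpq
  · simp only [Finset.sum_ite_eq', Finset.mem_univ, if_true, ← Finset.mul_sum]
    rfl
  · simp only [Finset.sum_ite_eq', Finset.mem_univ, if_true]

/-- A separable channel whose mixtures with the swap channel are separable as long as the weight of
the swap is at most `K⁻²`. -/
theorem exists_complement_swapChannel (hK : 1 ≤ K) :
    ∃ G : OpMap (Fin K × Fin K) (Fin K × Fin K), IsSeparableChannel G ∧
      ∀ t : ℝ, 0 ≤ t → t ≤ ((K : ℝ) ^ 2)⁻¹ →
        IsSeparableChannel ((t : ℂ) • swapChannel K + ((1 - t : ℝ) : ℂ) • G) := by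
  rcases hK.eq_or_lt with rfl | hK
  -- For `K = 1` the complement `wrongSwap` degenerates, but the swap is the identity and serves as
  -- its own complement.
  · have h : IsSeparableChannel (swapChannel 1) := by
      refine isSeparableChannel_of_kraus isChannel_swapChannel.2 (ι := Unit) (fun _ => 1)
        (fun _ => 1) fun X => ?_
      ext p q
      rw [swapChannel_apply, one_kronecker_one]
      simp [Subsingleton.elim p.swap p, Subsingleton.elim q.swap q]
    refine ⟨_, h, fun t h0 h1 => h.convex h h0 (by simpa using h1)⟩
  · refine ⟨wrongSwap K, isSeparableChannel_wrongSwap hK, fun t h0 h1 => ?_⟩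
    have hK1 := one_lt_sq_of_two_le hK
    -- Weight `t` on the swap is weight `t K²` on the threshold mixture, the rest being `wrongSwap`.
    have h := (isSeparableChannel_threshold hK).convex (isSeparableChannel_wrongSwap hK)
      (t := t * (K : ℝ) ^ 2) (by positivity) (by rwa [← le_inv_mul_iff₀' (by linarith), mul_one])
    convert! h using 1
    have hd : (K : ℂ) ≠ 0 := by
      have : K ≠ 0 := by omega
      exact_mod_cast this
    rw [smul_add, smul_smul, smul_smul, add_assoc, ← add_smul]
    congr 2
    · push_cast; field_simp
    · push_cast; field_simp; ring

end Swap

/-! ### From a test to a distilling superchannel. -/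

section Achievability

variable {k m n m' n' r e : Type*}

theorem IsChannel.comp [Fintype k] [Fintype m] [Fintype n] {S : OpMap n k} {T : OpMap m n}
    (hS : IsChannel S) (hT : IsChannel T) : IsChannel (S ∘ₗ T) :=
  ⟨hS.1.comp hT.1, fun X => (hS.2 _).trans (hT.2 X)⟩

/-- Renaming the basis of a system. -/
def renameBasis (f : m ≃ n) : OpMap n m where
  toFun X := X.submatrix f f
  map_add' _ _ := rfl
  map_smul' _ _ := rfl

theorem isChannel_renameBasis [Fintype m] [Fintype n] (f : m ≃ n) : IsChannel (renameBasis f) :=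
  ⟨fun r _ hX => hX.submatrix (Prod.map f id : m × Fin r → n × Fin r),
    fun X => f.sum_comp fun i => X i i⟩

theorem isSuperchannel_of_memory [Fintype m] [Fintype n] [Fintype m'] [Fintype n'] [Fintype e]
    {Θ : Supermap m n m' n'} {pre : OpMap m' (m × e)} {post : OpMap (n × e) n'}
    (hpre : IsChannel pre) (hpost : IsChannel post)
    (h : ∀ N X, Θ N X = post (applyLeft N (pre X))) : IsSuperchannel Θ := by
  let f := Fintype.equivFin e
  refine ⟨Fintype.card e, renameBasis ((Equiv.refl m).prodCongr f.symm) ∘ₗ pre,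
    post ∘ₗ renameBasis ((Equiv.refl n).prodCongr f), (isChannel_renameBasis _).comp hpre,
    hpost.comp (isChannel_renameBasis _), fun N X => ?_⟩
  rw [h]
  change post _ = post _
  congr 1
  ext ⟨p, a⟩ ⟨q, b⟩
  simp only [renameBasis, applyLeft, LinearMap.comp_apply, LinearMap.coe_mk, AddHom.coe_mk,
    submatrix_apply, of_apply, Equiv.prodCongr_apply, Prod.map_apply, Equiv.coe_refl, id_eq,
    Equiv.symm_apply_apply]

variable [Fintype m] [Fintype n] [Fintype m'] [Fintype n'] [Fintype r]

/-- Adjoining the pure state `ψ`, whose first part comes first. -/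
def adjoin (ψ : m × r → ℂ) : OpMap m' (m × (r × m')) where
  toFun X := of fun p q => X p.2.2 q.2.2 * pureState ψ (p.1, p.2.1) (q.1, q.2.1)
  map_add' X Y := by ext; simp [add_mul]
  map_smul' c X := by ext; simp [mul_assoc]

theorem isChannel_adjoin {ψ : m × r → ℂ} (hψ : ∑ i, ‖ψ i‖ ^ 2 = 1) :
    IsChannel (adjoin (m' := m') ψ) := by
  classical
  refine ⟨isCompletelyPositive_of_kraus (ι := Unit)
    (K := fun _ => of fun p k => if p.2.2 = k then ψ (p.1, p.2.1) else 0) fun X => ?_, fun X => ?_⟩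
  · ext p q
    simp only [adjoin, pureState, LinearMap.coe_mk, AddHom.coe_mk, of_apply, vecMulVec_apply,
      Finset.univ_unique, Finset.sum_const, Finset.card_singleton, one_smul, mul_apply,
      conjTranspose_apply, ite_mul, zero_mul, Finset.sum_ite_eq, Finset.mem_univ, if_true,
      apply_ite star, star_zero, mul_ite, mul_zero, Pi.star_apply]
    ring
  · have h := trace_pureState ψ
    rw [hψ, Complex.ofReal_one] at h
    simp only [trace, diag_apply, Fintype.sum_prod_type] at h
    simp only [adjoin, trace, diag_apply, LinearMap.coe_mk, AddHom.coe_mk, of_apply,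
      Fintype.sum_prod_type, ← Finset.sum_mul, ← Finset.mul_sum, h, mul_one]

/-- The unnormalized state of the second system after the outcome `Q` on the first one. -/
def outcome (Q : Matrix (n × r) (n × r) ℂ) : OpMap (n × (r × m')) m' where
  toFun Y := of fun k l =>
    (Q * of fun p q : n × r => Y (p.1, (p.2, k)) (q.1, (q.2, l))).trace
  map_add' X Y := by
    ext k l
    simp only [of_apply, Matrix.add_apply, ← trace_add, ← Matrix.mul_add]
    rfl
  map_smul' c X := by
    ext k l
    simp only [of_apply, Matrix.smul_apply, RingHom.id_apply, ← trace_smul, ← Matrix.mul_smul]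
    rfl

theorem isCompletelyPositive_outcome {Q : Matrix (n × r) (n × r) ℂ} (hQ : Q.PosSemidef) :
    IsCompletelyPositive (outcome (m' := m') Q) := by
  classical
  obtain ⟨k, v, rfl⟩ := exists_sum_pureState hQ
  refine isCompletelyPositive_of_kraus
    (K := fun i => of fun k p => if k = p.2.2 then star (v i (p.1, p.2.1)) else 0) fun X => ?_
  ext a b
  simp only [outcome, LinearMap.coe_mk, AddHom.coe_mk, of_apply, Matrix.sum_mul, trace_sum,
    Matrix.sum_apply]
  refine Finset.sum_congr rfl fun i _ => ?_
  rw [trace_mul_comm, trace_mul_pureState]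
  simp only [dotProduct, mulVec, mul_apply, of_apply, conjTranspose_apply, Fintype.sum_prod_type,
    ite_mul, zero_mul, Finset.sum_ite_eq, Finset.mem_univ, if_true, apply_ite star, star_zero,
    mul_ite, mul_zero, star_star, Pi.star_apply, Finset.sum_mul, Finset.mul_sum]
  have h := Finset.sum_comm (s := Finset.univ) (t := Finset.univ) (f := fun p q : n × r =>
    star (v i p) * (X (p.1, p.2, a) (q.1, q.2, b) * v i q))
  simpa only [Fintype.sum_prod_type, mul_assoc] using h

theorem outcome_adjoin (N : OpMap m n) (ψ : m × r → ℂ) (Q : Matrix (n × r) (n × r) ℂ)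
    (X : Matrix m' m' ℂ) :
    outcome Q (applyLeft N (adjoin ψ X)) = (Q * applyLeft N (pureState ψ)).trace • X := by
  ext k l
  have h : (of fun p q : n × r => applyLeft N (adjoin ψ X) (p.1, (p.2, k)) (q.1, (q.2, l))) =
      X k l • applyLeft N (pureState ψ) := by
    rw [← applyLeft_smul]
    rfl
  simp only [outcome, LinearMap.coe_mk, AddHom.coe_mk, of_apply, h, Matrix.mul_smul, trace_smul,
    Matrix.smul_apply, smul_eq_mul, mul_comm]

/-- The supermap that applies `F` or `G` according to the outcome of the test `Q` on `N(ψ)`. -/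
def testSupermap [DecidableEq n] [DecidableEq r] (ψ : m × r → ℂ) (Q : Matrix (n × r) (n × r) ℂ)
    (F G : OpMap m' n') : Supermap m n m' n' where
  toFun N := (Q * applyLeft N (pureState ψ)).trace • F +
    ((1 - Q) * applyLeft N (pureState ψ)).trace • G
  map_add' N N' := by
    have h : applyLeft (N + N') (pureState ψ) =
      applyLeft N (pureState ψ) + applyLeft N' (pureState ψ) := rfl
    simp only [h, Matrix.mul_add, trace_add, add_smul]
    abel
  map_smul' c N := by
    have h : applyLeft (c • N) (pureState ψ) = c • applyLeft N (pureState ψ) := rfl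
    simp only [h, Matrix.mul_smul, trace_smul, smul_eq_mul, mul_smul, smul_add, RingHom.id_apply]

/-- The memory holds the reference of `ψ` and the untouched input; post-processing measures `Q`
against `1 - Q` and applies `F` or `G` to the stored input. -/
theorem isSuperchannel_testSupermap [DecidableEq n] [DecidableEq r] {ψ : m × r → ℂ}
    (hψ : ∑ i, ‖ψ i‖ ^ 2 = 1) {Q : Matrix (n × r) (n × r) ℂ} (hQ : Q.PosSemidef)
    (hQ' : (1 - Q).PosSemidef) {F G : OpMap m' n'} (hF : IsChannel F) (hG : IsChannel G) :
    IsSuperchannel (testSupermap ψ Q F G) := by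
  refine isSuperchannel_of_memory (isChannel_adjoin hψ)
    (post := F ∘ₗ outcome Q + G ∘ₗ outcome (1 - Q)) ⟨(hF.1.comp
      (isCompletelyPositive_outcome hQ)).add (hG.1.comp (isCompletelyPositive_outcome hQ')),
      fun Y => ?_⟩ fun N X => ?_
  · rw [LinearMap.add_apply, trace_add, LinearMap.comp_apply, LinearMap.comp_apply, hF.2, hG.2]
    simp only [outcome, LinearMap.coe_mk, AddHom.coe_mk, trace, diag_apply, of_apply]
    rw [← Finset.sum_add_distrib]
    have h : ∀ k : m', ∑ i, (Q * of fun p q : n × r => Y (p.1, (p.2, k)) (q.1, (q.2, k))) i i +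
        ∑ i, ((1 - Q) * of fun p q : n × r => Y (p.1, (p.2, k)) (q.1, (q.2, k))) i i =
        ∑ i : n × r, Y (i.1, (i.2, k)) (i.1, (i.2, k)) := by
      intro k
      rw [← Finset.sum_add_distrib]
      refine Finset.sum_congr rfl fun i _ => ?_
      rw [← Matrix.add_apply, ← Matrix.add_mul, add_sub_cancel, Matrix.one_mul]
      rfl
    rw [Finset.sum_congr rfl fun k _ => h k, Finset.sum_comm]
    simp only [Fintype.sum_prod_type]
  · rw [LinearMap.add_apply, LinearMap.comp_apply, LinearMap.comp_apply, outcome_adjoin,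
      outcome_adjoin, map_smul, map_smul]
    rfl

theorem ofReal_testProb {N : OpMap m n} (hN : IsCompletelyPositive N) (ψ : m × r → ℂ)
    {Q : Matrix (n × r) (n × r) ℂ} (hQ : Q.PosSemidef) :
    0 ≤ testProb N ψ Q ∧ (Q * applyLeft N (pureState ψ)).trace = (testProb N ψ Q : ℂ) := by
  have h := Complex.le_def.1 (trace_mul_nonneg hQ (hN.posSemidef (posSemidef_pureState ψ)))
  exact ⟨h.1, Complex.ext rfl h.2.symm⟩

theorem testSupermap_apply [DecidableEq n] [DecidableEq r] {ψ : m × r → ℂ}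
    (hψ : ∑ i, ‖ψ i‖ ^ 2 = 1) {Q : Matrix (n × r) (n × r) ℂ} (hQ : Q.PosSemidef)
    (F G : OpMap m' n') {N : OpMap m n} (hN : IsChannel N) :
    testSupermap ψ Q F G N =
      (testProb N ψ Q : ℂ) • F + ((1 - testProb N ψ Q : ℝ) : ℂ) • G := by
  change (_ : ℂ) • F + (_ : ℂ) • G = _
  rw [sub_mul, one_mul, trace_sub, (ofReal_testProb hN.1 ψ hQ).2, trace_applyLeft hN.2,
    trace_pureState, hψ]
  push_cast
  rfl

theorem testProb_le_one [DecidableEq n] [DecidableEq r] {ψ : m × r → ℂ}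
    (hψ : ∑ i, ‖ψ i‖ ^ 2 = 1) {Q : Matrix (n × r) (n × r) ℂ} (hQ' : (1 - Q).PosSemidef)
    {N : OpMap m n} (hN : IsChannel N) : testProb N ψ Q ≤ 1 := by
  have h := re_trace_mul_nonneg hQ' (hN.1.posSemidef (posSemidef_pureState ψ))
  rw [sub_mul, one_mul, trace_sub, trace_applyLeft hN.2, trace_pureState, hψ, Complex.sub_re] at h
  simpa [testProb] using h

/-- A test that separable channels pass with probability at most `K⁻²` distils the `K`-swap. -/
theorem le_distillableEnt_of_test {A₀ B₀ A₁ B₁ : Type*}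
    [Fintype A₀] [Fintype B₀] [Fintype A₁] [Fintype B₁] [DecidableEq A₁] [DecidableEq B₁]
    [DecidableEq r] {N : OpMap (A₀ × B₀) (A₁ × B₁)} (hN : IsChannel N) {ε : ℝ}
    {ψ : (A₀ × B₀) × r → ℂ} (hψ : ∑ i, ‖ψ i‖ ^ 2 = 1)
    {Q : Matrix ((A₁ × B₁) × r) ((A₁ × B₁) × r) ℂ} (hQ : Q.PosSemidef) (hQ' : (1 - Q).PosSemidef)
    (hNQ : 1 - ε ≤ testProb N ψ Q) {K : ℕ} (hK : 1 ≤ K)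
    (hsep : ∀ M, IsSeparableChannel M → testProb M ψ Q ≤ ((K : ℝ) ^ 2)⁻¹) :
    ((Real.logb 2 ((K : ℝ) ^ 2) : ℝ) : EReal) ≤ distillableEnt ε N := by
  obtain ⟨G, hG, hGF⟩ := exists_complement_swapChannel hK
  refine le_sSup ⟨K, testSupermap ψ Q (swapChannel K) G, hK,
    ⟨isSuperchannel_testSupermap hψ hQ hQ' isChannel_swapChannel hG.isChannel, fun M hM => ?_⟩,
    ?_, rfl⟩
  · rw [testSupermap_apply hψ hQ _ _ hM.isChannel]
    exact hGF _ (ofReal_testProb hM.isChannel.1 ψ hQ).1 (hsep M hM)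
  · have h : testSupermap ψ Q (swapChannel K) G N - swapChannel K =
        ((1 - testProb N ψ Q : ℝ) : ℂ) • (G - swapChannel K) := by
      rw [testSupermap_apply hψ hQ _ _ hN]
      push_cast
      module
    rw [h]
    refine (diamondNorm_smul_sub_le hG.isChannel isChannel_swapChannel
      (sub_nonneg.2 (testProb_le_one hψ hQ' hN))).trans (ENNReal.ofReal_le_ofReal ?_)
    linarith

end Achievability

/-! ### From a distilling superchannel to a test. -/

section Converse

variable {m n r : Type*} [Fintype m] [Fintype n] [Fintype r]

/-- The adjoint of a positive trace-preserving map sends tests to tests. -/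
theorem exists_adjoint_test [DecidableEq m] [DecidableEq n] {T : OpMap m n}
    (hT : ∀ X : Matrix m m ℂ, X.PosSemidef → (T X).PosSemidef) (htr : IsTracePreserving T)
    {P : Matrix n n ℂ} (hP : P.PosSemidef) (hP' : (1 - P).PosSemidef) :
    ∃ Q : Matrix m m ℂ, Q.PosSemidef ∧ (1 - Q).PosSemidef ∧
      ∀ X, (Q * X).trace = (P * T X).trace := by
  set Q : Matrix m m ℂ := of fun i j => (P * T (single j i 1)).trace
  have hQ : ∀ X, (Q * X).trace = (P * T X).trace := by
    intro X
    conv_rhs => rw [matrix_eq_sum_single X]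
    have h : ∀ i j, single i j (X i j) = X i j • (single i j 1 : Matrix m m ℂ) := fun i j => by
      rw [smul_single, smul_eq_mul, mul_one]
    simp only [h, map_sum, map_smul, Matrix.mul_sum, trace_sum, Matrix.mul_smul, trace_smul]
    rw [Finset.sum_comm]
    have h2 : (Q * X).trace = ∑ i, ∑ j, Q i j * X j i := rfl
    rw [h2]
    simp only [Q, of_apply, smul_eq_mul, mul_comm]
  refine ⟨Q, posSemidef_of_trace_mul_pureState_nonneg fun v => ?_,
    posSemidef_of_trace_mul_pureState_nonneg fun v => ?_, hQ⟩
  · rw [hQ]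
    exact trace_mul_nonneg hP (hT _ (posSemidef_pureState v))
  · rw [sub_mul, one_mul, trace_sub, hQ, ← htr, ← trace_sub]
    have := trace_mul_nonneg hP' (hT _ (posSemidef_pureState v))
    rwa [sub_mul, one_mul] at this

theorem le_negLog2 {p x : ℝ} (hp : p ≤ x⁻¹) :
    ((Real.logb 2 x : ℝ) : EReal) ≤ negLog2 p := by
  rw [negLog2]
  split_ifs with h
  · exact le_top
  · rw [EReal.coe_le_coe_iff, le_neg, ← Real.logb_inv]
    exact Real.logb_le_logb_of_le one_lt_two (not_le.1 h) hp

variable {A₀ B₀ A₁ B₁ : Type*} [Fintype A₀] [Fintype B₀] [Fintype A₁] [Fintype B₁]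
  [DecidableEq A₁] [DecidableEq B₁]

theorem testProb_reindex {s : Type*} [Fintype s] (f : s ≃ r) (N : OpMap m n) (ψ : m × r → ℂ)
    (Q : Matrix (n × r) (n × r) ℂ) :
    testProb N (ψ ∘ Prod.map id f) (Q.submatrix (Prod.map id f) (Prod.map id f)) =
      testProb N ψ Q := by
  have h := submatrix_mul_equiv Q (applyLeft N (pureState ψ)) (Prod.map id f)
    ((Equiv.refl n).prodCongr f) (Prod.map id f)
  change (Q.submatrix (Prod.map id f) (Prod.map id f) *
    (applyLeft N (pureState ψ)).submatrix (Prod.map id f) (Prod.map id f)).trace.re = _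
  refine (congrArg (fun A => (trace A).re) h).trans ?_
  exact congrArg Complex.re (((Equiv.refl n).prodCongr f).sum_comp
    (fun i => (Q * applyLeft N (pureState ψ)) i i))

/-- A pure state with any finite reference and a test bound `E_H` from below. -/
theorem le_hypTestEnt_of_pure [DecidableEq r] {δ x : ℝ}
    {N : OpMap (A₀ × B₀) (A₁ × B₁)} {ψ : (A₀ × B₀) × r → ℂ} (hψ : ∑ i, ‖ψ i‖ ^ 2 = 1)
    {Q : Matrix ((A₁ × B₁) × r) ((A₁ × B₁) × r) ℂ} (hQ : Q.PosSemidef) (hQ' : (1 - Q).PosSemidef)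
    (hN : 1 - δ ≤ testProb N ψ Q) (hsep : ∀ M, IsSeparableChannel M → testProb M ψ Q ≤ x⁻¹) :
    ((Real.logb 2 x : ℝ) : EReal) ≤ hypTestEnt δ N := by
  set f : Fin (Fintype.card r) ≃ r := (Fintype.equivFin r).symm
  refine le_iSup_of_le (Fintype.card r) <| le_iSup_of_le (ψ ∘ Prod.map id f) <| le_iSup_of_le ?_ <|
    le_iSup_of_le (Q.submatrix (Prod.map id f) (Prod.map id f)) <| le_iSup_of_le ⟨?_, ?_, ?_⟩ <|
    le_iInf fun M => le_iInf fun hM => ?_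
  · rw [← hψ]
    exact ((Equiv.refl _).prodCongr f).sum_comp (fun i => ‖ψ i‖ ^ 2)
  · exact hQ.submatrix _
  · have h := hQ'.submatrix (Prod.map id f : (A₁ × B₁) × _ → (A₁ × B₁) × r)
    rw [submatrix_sub] at h
    have h1 : (1 : Matrix ((A₁ × B₁) × r) ((A₁ × B₁) × r) ℂ).submatrix (Prod.map id f)
        (Prod.map id f) = 1 := submatrix_one_equiv ((Equiv.refl _).prodCongr f)
    rwa [← h1]
  · rwa [testProb_reindex]
  · rw [testProb_reindex]
    exact le_negLog2 (hsep M hM)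

/-- Mixed states do not help, because they may be purified. -/
theorem le_hypTestEnt_of_mixed [DecidableEq r] {δ x : ℝ}
    {N : OpMap (A₀ × B₀) (A₁ × B₁)} {ρ : Matrix ((A₀ × B₀) × r) ((A₀ × B₀) × r) ℂ}
    (hρ : ρ.PosSemidef) (hρ' : ρ.trace = 1)
    {Q : Matrix ((A₁ × B₁) × r) ((A₁ × B₁) × r) ℂ} (hQ : Q.PosSemidef) (hQ' : (1 - Q).PosSemidef)
    (hN : 1 - δ ≤ (Q * applyLeft N ρ).trace.re)
    (hsep : ∀ M, IsSeparableChannel M → (Q * applyLeft M ρ).trace.re ≤ x⁻¹) :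
    ((Real.logb 2 x : ℝ) : EReal) ≤ hypTestEnt δ N := by
  obtain ⟨k, v, rfl⟩ := exists_sum_pureState hρ
  -- The purification is `∑ i, v i ⊗ |i⟩`; the test `Q ⊗ 1` ignores the new register, so only its
  -- diagonal blocks enter.
  set ψ : (A₀ × B₀) × (r × Fin k) → ℂ := fun p => v p.2.2 (p.1, p.2.1)
  set g : (A₁ × B₁) × (r × Fin k) ≃ ((A₁ × B₁) × r) × Fin k := (Equiv.prodAssoc _ _ _).symm
  set Q' := (Q ⊗ₖ (1 : Matrix (Fin k) (Fin k) ℂ)).submatrix g g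
  have htest : ∀ M : OpMap (A₀ × B₀) (A₁ × B₁),
      testProb M ψ Q' = (Q * applyLeft M (∑ i, pureState (v i))).trace.re := by
    intro M
    have h1 : ∀ p q i, applyLeft M (pureState ψ) (p.1, (p.2, i)) (q.1, (q.2, i)) =
      applyLeft M (pureState (v i)) p q := fun p q i => rfl
    rw [applyLeft_sum, Matrix.mul_sum, trace_sum, testProb]
    congr 1
    simp only [trace, diag_apply, mul_apply, ← h1, Q', g, submatrix_apply, kroneckerMap_apply,
      Fintype.sum_prod_type, Equiv.prodAssoc_symm_apply, one_apply, mul_ite, mul_one, mul_zero,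
      ite_mul, zero_mul, Finset.sum_ite_eq, Finset.mem_univ, if_true]
    have h2 := Finset.sum_comm (s := Finset.univ) (t := Finset.univ)
      (f := fun (a : (A₁ × B₁) × r) (i : Fin k) => ∑ b : (A₁ × B₁) × r,
        Q a b * applyLeft M (pureState ψ) (b.1, (b.2, i)) (a.1, (a.2, i)))
    simpa only [Fintype.sum_prod_type] using h2
  refine le_hypTestEnt_of_pure (Q := Q') (ψ := ψ) ?_ ?_ ?_ ?_ ?_
  · have h : ((∑ i, ‖ψ i‖ ^ 2 : ℝ) : ℂ) = 1 := by
      rw [← hρ', trace_sum]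
      simp only [trace_pureState, ← Complex.ofReal_sum, Fintype.sum_prod_type, ψ]
      have h2 := Finset.sum_comm (s := Finset.univ) (t := Finset.univ)
        (f := fun (a : (A₀ × B₀) × r) (i : Fin k) => ‖v i a‖ ^ 2)
      simpa only [Fintype.sum_prod_type, Complex.ofReal_inj] using h2
    exact_mod_cast h
  · exact (hQ.kronecker PosSemidef.one).submatrix g
  · have h : 1 - Q' = ((1 - Q) ⊗ₖ (1 : Matrix (Fin k) (Fin k) ℂ)).submatrix g g := by
      rw [← submatrix_one_equiv g, ← one_kronecker_one (α := ℂ)]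
      ext p q
      simp only [Q', submatrix_apply, Matrix.sub_apply, kroneckerMap_apply, sub_mul]
    rw [h]
    exact (hQ'.kronecker PosSemidef.one).submatrix g
  · rwa [htest]
  · intro M hM
    rw [htest]
    exact hsep M hM

variable {K : ℕ}

/-- The maximally entangled state of the two inputs of the swap gate with a reference. -/
noncomputable def maxEntangled [DecidableEq r] (f : Fin K × Fin K ≃ r)
    (p : (Fin K × Fin K) × r) : ℂ :=
  if f p.1 = p.2 then (K : ℂ)⁻¹ else 0

/-- The Choi state of the swap gate. -/
noncomputable def swapState [DecidableEq r] (f : Fin K × Fin K ≃ r) (p : (Fin K × Fin K) × r) : ℂ :=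
  maxEntangled f (p.1.swap, p.2)

theorem sum_norm_maxEntangled [DecidableEq r] (hK : 1 ≤ K) (f : Fin K × Fin K ≃ r) :
    ∑ p, ‖maxEntangled f p‖ ^ 2 = 1 := by
  have hK0 : (K : ℝ) ≠ 0 := by
    have : K ≠ 0 := by omega
    exact_mod_cast this
  have h : ∀ p, ‖maxEntangled f p‖ ^ 2 = if f p.1 = p.2 then ((K : ℝ) ^ 2)⁻¹ else 0 := fun p => by
    rw [maxEntangled]; split_ifs <;> simp
  rw [Finset.sum_congr rfl fun p _ => h p, Fintype.sum_prod_type]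
  simp only [Finset.sum_ite_eq, Finset.mem_univ, if_true, Finset.sum_const, Finset.card_univ,
    Fintype.card_prod, Fintype.card_fin, nsmul_eq_mul]
  push_cast
  field_simp

theorem sum_norm_swapState [DecidableEq r] (hK : 1 ≤ K) (f : Fin K × Fin K ≃ r) :
    ∑ p, ‖swapState f p‖ ^ 2 = 1 := by
  rw [← sum_norm_maxEntangled hK f]
  exact ((Equiv.prodComm (Fin K) (Fin K)).prodCongr (Equiv.refl r)).sum_comp
    (fun p => ‖maxEntangled f p‖ ^ 2)

theorem applyLeft_swapChannel [DecidableEq r] (f : Fin K × Fin K ≃ r) :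
    applyLeft (swapChannel K) (pureState (maxEntangled f)) = pureState (swapState f) := by
  ext p q
  rw [applyLeft, of_apply, swapChannel_apply]
  rfl

theorem trace_mul_conjTranspose_eq_sum {a b : Type*} [Fintype a] [Fintype b] (S : Matrix a b ℂ) :
    (S * Sᴴ).trace = ((∑ i, ∑ j, ‖S i j‖ ^ 2 : ℝ) : ℂ) := by
  simp [trace, mul_apply, Complex.mul_conj']

/-- Separable channels have fidelity at most `K⁻²` with the swap gate. -/
theorem re_trace_swapState_le [DecidableEq r] (hK : 1 ≤ K) (f : Fin K × Fin K ≃ r)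
    {M : OpMap (Fin K × Fin K) (Fin K × Fin K)} (hM : IsSeparableChannel M) :
    (pureState (swapState f) * applyLeft M (pureState (maxEntangled f))).trace.re ≤
      ((K : ℝ) ^ 2)⁻¹ := by
  obtain ⟨htr, k, S, T, hk⟩ := hM
  have hK0 : (K : ℝ) ≠ 0 := by
    have : K ≠ 0 := by omega
    exact_mod_cast this
  have hamp : ∀ i, star (swapState f) ⬝ᵥ (((S i ⊗ₖ T i) ⊗ₖ (1 : Matrix r r ℂ)) *ᵥ maxEntangled f) =
      ((K : ℂ) ^ 2)⁻¹ * ∑ a, ∑ b, S i b a * T i a b := by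
    intro i
    simp only [dotProduct, mulVec, swapState, maxEntangled, Pi.star_apply, kroneckerMap_apply,
      one_apply, apply_ite star, star_zero, mul_ite, mul_one, mul_zero, ite_mul, zero_mul,
      Fintype.sum_prod_type (α₂ := r), Finset.sum_ite_eq, Finset.mem_univ, if_true,
      EmbeddingLike.apply_eq_iff_eq]
    rw [Finset.sum_comm]
    simp only [Fintype.sum_prod_type, Prod.fst_swap, Prod.snd_swap, star_inv₀, star_natCast,
      Finset.mul_sum]
    refine Finset.sum_congr rfl fun a _ => Finset.sum_congr rfl fun b _ => ?_
    ring
  -- Cauchy–Schwarz bounds the amplitude by the Hilbert–Schmidt norms of `S i` and `T i`, whose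
  -- squared product is the trace of the Kraus term at `1`. Summed over `i`, these traces give `tr
  -- M(1) = K²`, hence `K⁻⁴ K² = K⁻²`.
  have hterm : ∀ i, (pureState (swapState f) * (((S i ⊗ₖ T i) ⊗ₖ (1 : Matrix r r ℂ)) *
      pureState (maxEntangled f) * ((S i ⊗ₖ T i) ⊗ₖ (1 : Matrix r r ℂ))ᴴ)).trace.re ≤
      ((K : ℝ) ^ 4)⁻¹ * ((S i ⊗ₖ T i) * 1 * (S i ⊗ₖ T i)ᴴ).trace.re := by
    intro i
    set L := (S i ⊗ₖ T i) ⊗ₖ (1 : Matrix r r ℂ)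
    have h1 : L * pureState (maxEntangled f) * Lᴴ = pureState (L *ᵥ maxEntangled f) := by
      rw [pureState, mul_vecMulVec, vecMulVec_mul, pureState, star_mulVec]
    have h2 : (pureState (swapState f) * pureState (L *ᵥ maxEntangled f)).trace.re =
        ‖((K : ℂ) ^ 2)⁻¹ * ∑ a, ∑ b, S i b a * T i a b‖ ^ 2 := by
      rw [← hamp, trace_mul_pureState, pureState, vecMulVec_mulVec, dotProduct_smul,
        MulOpposite.smul_eq_mul_unop, MulOpposite.unop_op]
      set w := L *ᵥ maxEntangled f
      have h3 : star w ⬝ᵥ swapState f = star (star (swapState f) ⬝ᵥ w) := by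
        rw [star_dotProduct]
      rw [h3, RCLike.star_def, Complex.conj_mul', ← Complex.ofReal_pow, Complex.ofReal_re]
    have h4 : ((S i ⊗ₖ T i) * 1 * (S i ⊗ₖ T i)ᴴ).trace.re =
        (∑ a, ∑ b, ‖S i b a‖ ^ 2) * ∑ a, ∑ b, ‖T i a b‖ ^ 2 := by
      rw [Matrix.mul_one, conjTranspose_kronecker, ← mul_kronecker_mul, trace_kronecker,
        trace_mul_conjTranspose_eq_sum, trace_mul_conjTranspose_eq_sum, ← Complex.ofReal_mul,
        Complex.ofReal_re, Finset.sum_comm]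
    have h5 : ‖∑ a, ∑ b, S i b a * T i a b‖ ^ 2 ≤
        (∑ a, ∑ b, ‖S i b a‖ ^ 2) * ∑ a, ∑ b, ‖T i a b‖ ^ 2 := by
      simp only [← Fintype.sum_prod_type']
      refine le_trans ?_ (Finset.sum_mul_sq_le_sq_mul_sq _ _ _)
      gcongr
      refine (norm_sum_le _ _).trans_eq ?_
      simp
    rw [h1, h2, h4, norm_mul, mul_pow]
    gcongr
    simp [← pow_mul]
  rw [applyLeft_kraus hk, Matrix.mul_sum, trace_sum, Complex.re_sum]
  refine (Finset.sum_le_sum fun i _ => hterm i).trans_eq ?_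
  rw [← Finset.mul_sum, ← Complex.re_sum, ← trace_sum, ← hk, htr, trace_one]
  simp only [Fintype.card_prod, Fintype.card_fin]
  push_cast
  rw [← Complex.ofReal_natCast, ← Complex.ofReal_mul, Complex.ofReal_re]
  field_simp

theorem posSemidef_one_sub_pureState [DecidableEq m] {v : m → ℂ} (hv : ∑ i, ‖v i‖ ^ 2 = 1) :
    (1 - pureState v).PosSemidef := by
  have h := posSemidef_trace_smul_one_sub (posSemidef_pureState v)
  rwa [trace_pureState, hv, Complex.ofReal_one, one_smul] at h

theorem distillableEnt_le {N : OpMap (A₀ × B₀) (A₁ × B₁)} {ε : ℝ} (hε : 0 ≤ ε) :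
    distillableEnt ε N ≤ hypTestEnt (2 * ε) N := by
  classical
  refine sSup_le ?_
  rintro _ ⟨K, Θ, hK, ⟨⟨e, pre, post, hpre, hpost, hΘ⟩, hsep⟩, hdist, rfl⟩
  set c := Fintype.card (Fin K × Fin K)
  set f : Fin K × Fin K ≃ Fin c := Fintype.equivFin _
  set X := pureState (maxEntangled f)
  set P := pureState (swapState f)
  have hP : P.PosSemidef := posSemidef_pureState _
  have hP' : (1 - P).PosSemidef := posSemidef_one_sub_pureState (sum_norm_swapState hK f)
  have hX : X.PosSemidef := posSemidef_pureState _
  have hXtr : X.trace = 1 := by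
    rw [trace_pureState, sum_norm_maxEntangled hK, Complex.ofReal_one]
  -- The factor two arises here: the deviation of the test is bounded by the full trace norm,
  -- whereas `ε` bounds half the diamond norm.
  have hfid : 1 - 2 * ε ≤ (P * applyLeft (Θ N) X).trace.re := by
    have hXn : traceNorm X ≤ 1 := by
      simpa [hXtr] using traceNorm_of_posSemidef_le hX
    have h1 : ENNReal.ofReal (traceNorm (applyLeft (Θ N - swapChannel K) X)) ≤
        ENNReal.ofReal (2 * ε) := by
      have h2 : ENNReal.ofReal (traceNorm (applyLeft (Θ N - swapChannel K) X)) ≤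
          diamondNorm (Θ N - swapChannel K) :=
        le_iSup_of_le c <| le_iSup_of_le X <| le_iSup_of_le hXn le_rfl
      calc _ ≤ 2 * (2⁻¹ * diamondNorm (Θ N - swapChannel K)) := by
            rwa [← mul_assoc, ENNReal.mul_inv_cancel two_ne_zero ENNReal.ofNat_ne_top, one_mul]
        _ ≤ 2 * ENNReal.ofReal ε := by gcongr
        _ = _ := by rw [ENNReal.ofReal_mul zero_le_two, ENNReal.ofReal_ofNat]
    rw [ENNReal.ofReal_le_ofReal_iff (by positivity)] at h1
    have h3 := neg_traceNorm_le_re_trace_mul hP hP' (applyLeft (Θ N - swapChannel K) X)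
    have h4 : applyLeft (Θ N - swapChannel K) X = applyLeft (Θ N) X - P := by
      simp only [P, ← applyLeft_swapChannel f]; rfl
    have h5 : (P * P).trace = 1 := by
      have h6 : star (swapState f) ⬝ᵥ swapState f = P.trace := by
        rw [dotProduct_comm]; exact (trace_vecMulVec _ _).symm
      have h7 : P.trace = 1 := by rw [trace_pureState, sum_norm_swapState hK, Complex.ofReal_one]
      have h8 : P *ᵥ swapState f =
          MulOpposite.op (star (swapState f) ⬝ᵥ swapState f) • swapState f := vecMulVec_mulVec ..
      change (P * pureState _).trace = 1
      rw [trace_mul_pureState, h8, dotProduct_smul, h6, h7]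
      simp
    rw [h4, Matrix.mul_sub, trace_sub, h5, Complex.sub_re, Complex.one_re] at h3
    rw [h4] at h1
    linarith
  -- Seen from `N`, the memory and the reference of the entangled input together form one reference.
  set g := Equiv.prodAssoc (A₀ × B₀) (Fin e) (Fin c)
  set g' := Equiv.prodAssoc (A₁ × B₁) (Fin e) (Fin c)
  set ρ := (applyLeft pre X).submatrix g.symm g.symm
  obtain ⟨Q, hQ, hQ', hQP⟩ := exists_adjoint_test
    (T := applyLeftLin (Fin c) post ∘ₗ renameBasis g')
    (fun Y hY => hpost.1.posSemidef (hY.submatrix g'))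
    (fun Y => (trace_applyLeft hpost.2 _).trans ((isChannel_renameBasis g').2 Y)) hP hP'
  have hQM : ∀ M, (Q * applyLeft M ρ).trace = (P * applyLeft (Θ M) X).trace := by
    intro M
    rw [hQP]
    congr 2
    ext p q
    simp only [applyLeft, of_apply, hΘ]
    rfl
  refine le_hypTestEnt_of_mixed (ρ := ρ) (Q := Q) ((hpre.1.posSemidef hX).submatrix _) ?_ hQ hQ'
    ?_ fun M hM => ?_
  · exact (g.symm.sum_comp (fun i => applyLeft pre X i i)).trans
      ((trace_applyLeft hpre.2 X).trans hXtr)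
  · rwa [hQM]
  · rw [hQM]
    exact re_trace_swapState_le hK f (hsep M hM)

end Converse

/-! ### Domination by the depolarizing channel. -/

section Depolarizing

variable {m n r : Type*} [Fintype m] [Fintype n] [Fintype r]

/-- The completely depolarizing channel. -/
noncomputable def depolarize (m n : Type*) [Fintype m] [Fintype n] [DecidableEq n] : OpMap m n where
  toFun X := ((Fintype.card n : ℂ)⁻¹ * X.trace) • 1
  map_add' X Y := by rw [trace_add, mul_add, add_smul]
  map_smul' c X := by rw [trace_smul, smul_eq_mul, mul_left_comm, mul_smul]; rfl

theorem depolarize_apply [DecidableEq n] (X : Matrix m m ℂ) :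
    depolarize m n X = ((Fintype.card n : ℂ)⁻¹ * X.trace) • 1 := rfl

theorem isSeparableChannel_depolarize {A₀ B₀ A₁ B₁ : Type*} [Fintype A₀] [Fintype B₀] [Fintype A₁]
    [Fintype B₁] [DecidableEq A₁] [DecidableEq B₁] [Nonempty A₁] [Nonempty B₁] :
    IsSeparableChannel (depolarize (A₀ × B₀) (A₁ × B₁)) := by
  classical
  set c : ℂ := ((Real.sqrt ((Fintype.card (A₁ × B₁) : ℝ)⁻¹) : ℝ) : ℂ)
  have hc : c * c = (Fintype.card (A₁ × B₁) : ℂ)⁻¹ := by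
    rw [← Complex.ofReal_mul, Real.mul_self_sqrt (by positivity)]
    push_cast
    rfl
  refine isSeparableChannel_of_kraus (ι := (A₁ × B₁) × (A₀ × B₀)) (fun X => ?_)
    (fun i => c • Matrix.single i.1.1 i.2.1 1) (fun i => Matrix.single i.1.2 i.2.2 1)
    (fun X => ?_)
  · rw [depolarize_apply, trace_smul, trace_one, smul_eq_mul]
    field_simp
  · have h : ∀ i : (A₁ × B₁) × (A₀ × B₀),
        ((c • Matrix.single i.1.1 i.2.1 1) ⊗ₖ (Matrix.single i.1.2 i.2.2 1 : Matrix _ _ ℂ)) * X *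
        ((c • Matrix.single i.1.1 i.2.1 1) ⊗ₖ (Matrix.single i.1.2 i.2.2 1 : Matrix _ _ ℂ))ᴴ =
        Matrix.single i.1 i.1 (c * c * X i.2 i.2) := by
      rintro ⟨p, q⟩
      have hcc : star c = c := Complex.conj_ofReal _
      rw [smul_kronecker, single_kronecker_single, conjTranspose_smul, Matrix.smul_mul,
        Matrix.smul_mul, Matrix.mul_smul, conjTranspose_single, Matrix.single_mul_mul_single]
      simp only [smul_single]
      congr 1
      simp [hcc]
      ring
    rw [Finset.sum_congr rfl fun i _ => h i, Fintype.sum_prod_type, depolarize_apply]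
    ext p q
    simp only [Matrix.sum_apply, single_apply, ite_and, hc, Matrix.smul_apply, one_apply,
      smul_eq_mul, mul_ite, mul_one, mul_zero]
    rw [Finset.sum_comm]
    simp only [Finset.sum_ite_eq', Finset.mem_univ, if_true]
    split_ifs
    · rw [← Finset.mul_sum]; rfl
    · simp

/-- Every channel is dominated by a multiple of the completely depolarizing one. -/
theorem testProb_le_depolarize [DecidableEq n] [Nonempty n] {N : OpMap m n} (hN : IsChannel N)
    (ψ : m × r → ℂ) {Q : Matrix (n × r) (n × r) ℂ} (hQ : Q.PosSemidef) :
    testProb N ψ Q ≤ Fintype.card m * Fintype.card n * testProb (depolarize m n) ψ Q := by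
  classical
  set φ : m → m × r → ℂ := fun a p => if p.1 = a then ψ p else 0
  -- Pinching inequality: dephasing the input in its basis loses at most a factor `card m`, because
  -- the difference is a sum of squares over pairs `a, b`.
  have hpinch : ((Fintype.card m : ℂ) • ∑ a, pureState (φ a) - pureState ψ).PosSemidef := by
    have h : (Fintype.card m : ℂ) • ∑ a, pureState (φ a) - pureState ψ =
        ((2⁻¹ : ℝ) : ℂ) • ∑ a, ∑ b, pureState (φ a - φ b) := by
      ext p q
      simp only [Matrix.sub_apply, Matrix.smul_apply, Matrix.sum_apply, pureState, vecMulVec_apply,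
        Pi.star_apply, Pi.sub_apply, star_sub, sub_mul, mul_sub, Finset.sum_sub_distrib,
        Finset.sum_const, Finset.card_univ, ← Finset.mul_sum, ← Finset.sum_mul, nsmul_eq_mul,
        smul_eq_mul, ← star_sum]
      have h1 : ∀ p, ∑ a, φ a p = ψ p := fun p => by simp [φ]
      rw [h1, h1]
      push_cast
      ring
    rw [h]
    exact (posSemidef_sum _ fun a _ => posSemidef_sum _ fun b _ => posSemidef_pureState _).smul
      (Complex.zero_le_real.2 (by norm_num))
  have hprod : ∀ a, applyLeft N (pureState (φ a)) =
      N (single a a 1) ⊗ₖ pureState (fun x => ψ (a, x)) := by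
    intro a
    ext p q
    have h : (of fun k l => pureState (φ a) (k, p.2) (l, q.2) : Matrix m m ℂ) =
        pureState (fun x => ψ (a, x)) p.2 q.2 • single a a 1 := by
      ext k l
      simp only [of_apply, pureState, vecMulVec_apply, φ, Pi.star_apply, Matrix.smul_apply,
        single_apply, smul_eq_mul]
      by_cases hk : k = a <;> by_cases hl : l = a <;> simp [hk, hl, Ne.symm]
    rw [applyLeft, of_apply, h, map_smul, Matrix.smul_apply, smul_eq_mul, kroneckerMap_apply,
      mul_comm]
  have hdep : ((Fintype.card n : ℂ) • applyLeft (depolarize m n) (pureState ψ)) =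
      ∑ a, (1 : Matrix n n ℂ) ⊗ₖ pureState (fun x => ψ (a, x)) := by
    ext p q
    simp only [applyLeft, depolarize, LinearMap.coe_mk, AddHom.coe_mk, Matrix.smul_apply, of_apply,
      Matrix.sum_apply, kroneckerMap_apply, ← Finset.mul_sum, smul_eq_mul]
    have h0 : (Fintype.card n : ℂ) ≠ 0 := Nat.cast_ne_zero.2 Fintype.card_ne_zero
    rw [mul_assoc, mul_inv_cancel_left₀ h0, mul_comm]
    rfl
  -- After dephasing, `N` acts on the basis projectors only, and each output is at most `1` since it
  -- is positive of trace one.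
  have hle : ((Fintype.card n : ℂ) • applyLeft (depolarize m n) (pureState ψ) -
      applyLeft N (∑ a, pureState (φ a))).PosSemidef := by
    rw [applyLeft_sum, hdep, ← Finset.sum_sub_distrib]
    refine posSemidef_sum _ fun a _ => ?_
    have hE : (single a a 1 : Matrix m m ℂ).PosSemidef := by
      have : (single a a 1 : Matrix m m ℂ) = pureState (Pi.single a 1) := by
        ext k l
        simp only [single_apply, pureState, vecMulVec_apply, Pi.star_apply, Pi.single_apply]
        by_cases hk : k = a <;> by_cases hl : l = a <;> simp [hk, hl]
        all_goals grind
      rw [this]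
      exact posSemidef_pureState _
    have h1 := posSemidef_trace_smul_one_sub (hN.1.posSemidef_apply hE)
    rw [hN.2, trace_single_eq_same, one_smul] at h1
    have h2 := h1.kronecker (posSemidef_pureState (fun x => ψ (a, x)))
    convert! h2 using 1
    rw [hprod]
    ext p q
    simp only [Matrix.sub_apply, kroneckerMap_apply, sub_mul]
  have h1 := re_trace_mul_nonneg hQ (hN.1.posSemidef hpinch)
  have h2 := re_trace_mul_nonneg hQ hle
  rw [applyLeft_sub, applyLeft_smul, Matrix.mul_sub, trace_sub, Matrix.mul_smul, trace_smul,
    Complex.sub_re, smul_eq_mul, ← Complex.ofReal_natCast, Complex.re_ofReal_mul] at h1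
  rw [Matrix.mul_sub, trace_sub, Matrix.mul_smul, trace_smul,
    Complex.sub_re, smul_eq_mul, ← Complex.ofReal_natCast, Complex.re_ofReal_mul] at h2
  have h3 : (0 : ℝ) ≤ Fintype.card m := Nat.cast_nonneg _
  rw [testProb, testProb]
  nlinarith

end Depolarizing

/-! ### Bounding the dimension of the reference. -/

section Reduction

variable {m n r s : Type*} [Fintype m] [Fintype n] [Fintype r] [Fintype s]

theorem one_kronecker_conj_apply {l : Type*} [Fintype l] [DecidableEq l] (V : Matrix r s ℂ)
    (Y : Matrix (l × s) (l × s) ℂ) (p q : l × r) :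
    (((1 : Matrix l l ℂ) ⊗ₖ V) * Y * ((1 : Matrix l l ℂ) ⊗ₖ V)ᴴ) p q =
      ∑ j, ∑ i, (V p.2 i * star (V q.2 j)) * Y (p.1, i) (q.1, j) := by
  simp only [mul_apply, kroneckerMap_apply, conjTranspose_apply, Fintype.sum_prod_type, one_apply,
    ite_mul, one_mul, zero_mul, Finset.sum_mul, apply_ite star, star_zero, mul_ite, mul_zero]
  rw [Finset.sum_comm]
  refine Finset.sum_congr rfl fun j _ => ?_
  rw [Finset.sum_ite_eq, if_pos (Finset.mem_univ _), Finset.sum_comm]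
  refine Finset.sum_congr rfl fun i _ => ?_
  rw [Finset.sum_ite_eq, if_pos (Finset.mem_univ _)]
  ring

theorem applyLeft_conj [DecidableEq m] [DecidableEq n] (T : OpMap m n) (V : Matrix r s ℂ)
    (X : Matrix (m × s) (m × s) ℂ) :
    applyLeft T (((1 : Matrix m m ℂ) ⊗ₖ V) * X * ((1 : Matrix m m ℂ) ⊗ₖ V)ᴴ) =
      ((1 : Matrix n n ℂ) ⊗ₖ V) * applyLeft T X * ((1 : Matrix n n ℂ) ⊗ₖ V)ᴴ := by
  ext p q
  have h : (of fun k l => (((1 : Matrix m m ℂ) ⊗ₖ V) * X * ((1 : Matrix m m ℂ) ⊗ₖ V)ᴴ)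
      (k, p.2) (l, q.2) : Matrix m m ℂ) =
      ∑ j, ∑ i, (V p.2 i * star (V q.2 j)) • (of fun k l => X (k, i) (l, j) : Matrix m m ℂ) := by
    ext k l
    rw [of_apply, one_kronecker_conj_apply]
    simp only [Matrix.sum_apply, Matrix.smul_apply, of_apply, smul_eq_mul]
  rw [one_kronecker_conj_apply, applyLeft, of_apply, h]
  simp only [map_sum, map_smul, Matrix.sum_apply, Matrix.smul_apply, smul_eq_mul]
  rfl

/-- By the Schmidt decomposition, references need not be larger than the input system. -/
theorem exists_small_reference [DecidableEq m] [DecidableEq n] [DecidableEq r] {ψ : m × r → ℂ}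
    (hψ : ∑ i, ‖ψ i‖ ^ 2 = 1) {Q : Matrix (n × r) (n × r) ℂ} (hQ : Q.PosSemidef)
    (hQ' : (1 - Q).PosSemidef) :
    ∃ (φ : m × m → ℂ) (P : Matrix (n × m) (n × m) ℂ), ∑ i, ‖φ i‖ ^ 2 = 1 ∧ P.PosSemidef ∧
      (1 - P).PosSemidef ∧ ∀ M : OpMap m n, testProb M φ P = testProb M ψ Q := by
  -- With `ψ` reshaped as `Ψ = V S`, the state `φ` given by `S` has reference `m`, and `V`, acting
  -- on references alone, commutes with every channel and moves into the test.
  set Ψ : Matrix r m ℂ := of fun a i => ψ (i, a)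
  obtain ⟨V, U, s, -, -, -, hΨ, hVs, -, hV⟩ := exists_svd Ψ
  set S := diagonal s * Uᴴ
  have hΨS : Ψ = V * S := by rw [hΨ, Matrix.mul_assoc]
  set φ : m × m → ℂ := fun p => S p.2 p.1
  set W := (1 : Matrix n n ℂ) ⊗ₖ V
  have hψφ : pureState ψ =
      ((1 : Matrix m m ℂ) ⊗ₖ V) * pureState φ * ((1 : Matrix m m ℂ) ⊗ₖ V)ᴴ := by
    have h : ψ = ((1 : Matrix m m ℂ) ⊗ₖ V) *ᵥ φ := by
      ext ⟨i, a⟩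
      have h1 : ψ (i, a) = (V * S) a i := by rw [← hΨS]; rfl
      rw [h1]
      simp only [mulVec, dotProduct, kroneckerMap_apply, Fintype.sum_prod_type, one_apply, ite_mul,
        one_mul, zero_mul, mul_apply, φ]
      rw [Finset.sum_comm]
      simp
    rw [h, pureState, pureState, mul_vecMulVec, vecMulVec_mul, star_mulVec]
  refine ⟨φ, Wᴴ * Q * W, ?_, hQ.conjTranspose_mul_mul_same W, ?_, fun M => ?_⟩
  · have h1 : Ψᴴ * Ψ = Sᴴ * S := by
      have h : Ψᴴ * Ψ = (diagonal s * Uᴴ)ᴴ * (Vᴴ * V * diagonal s * Uᴴ) := by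
        rw [hΨ]
        simp only [conjTranspose_mul, Matrix.mul_assoc]
      rw [h, hVs]
    have h2 := congrArg trace h1
    rw [trace_mul_comm, trace_mul_comm Sᴴ, trace_mul_conjTranspose_eq_sum,
      trace_mul_conjTranspose_eq_sum, Complex.ofReal_inj] at h2
    rw [← hψ, Fintype.sum_prod_type_right, Fintype.sum_prod_type_right]
    exact h2.symm
  -- The summand with `1 - Vᴴ * V` accounts for `V` being only a partial isometry.
  · have h : 1 - Wᴴ * Q * W = Wᴴ * (1 - Q) * W + (1 : Matrix n n ℂ) ⊗ₖ (1 - Vᴴ * V) := by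
      have h1 : (1 : Matrix n n ℂ) ⊗ₖ (1 - Vᴴ * V) = 1 - Wᴴ * W := by
        have h2 : Wᴴ * W = (1 : Matrix n n ℂ) ⊗ₖ (Vᴴ * V) := by
          rw [conjTranspose_kronecker, ← mul_kronecker_mul, conjTranspose_one, Matrix.one_mul]
        rw [h2, ← one_kronecker_one]
        ext p q
        simp only [Matrix.sub_apply, kroneckerMap_apply, mul_sub]
      rw [h1, Matrix.mul_sub, Matrix.mul_one, Matrix.sub_mul]
      abel
    rw [h]
    exact (hQ'.conjTranspose_mul_mul_same W).add (PosSemidef.one.kronecker hV)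
  · rw [testProb, testProb, hψφ, applyLeft_conj, trace_mul_cycle']
    simp only [W, Matrix.mul_assoc]

end Reduction

/-! ### Existence of an optimal test. -/

section Compactness

variable {m n r : Type*} [Fintype m] [Fintype n] [Fintype r]

theorem isClosed_setOf_posSemidef : IsClosed {A : Matrix m m ℂ | A.PosSemidef} := by
  simp only [posSemidef_iff_dotProduct_mulVec, Set.ofPred_and, Set.ofPred_forall]
  refine IsClosed.inter (isClosed_eq (by fun_prop) continuous_id) (isClosed_iInter fun x => ?_)
  exact isClosed_le continuous_const (by fun_prop)

/-- Positivity gives `|Q i j| ≤ (Q i i + Q j j) / 2`, and the diagonal is at most one. This is the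
boundedness needed for compactness. -/
theorem norm_apply_le_one_of_test [DecidableEq m] {Q : Matrix m m ℂ} (hQ : Q.PosSemidef)
    (hQ' : (1 - Q).PosSemidef) (i j : m) : ‖Q i j‖ ≤ 1 := by
  have hd : ∀ i, (Q i i).re ≤ 1 := fun i => by
    have := (Complex.le_def.1 (hQ'.diag_nonneg (i := i))).1
    simpa using this
  obtain ⟨k, v, rfl⟩ := exists_sum_pureState hQ
  have hre : ∀ i, ((∑ l, pureState (v l)) i i).re = ∑ l, ‖v l i‖ ^ 2 := fun i => by
    simp [Matrix.sum_apply, pureState, vecMulVec_apply, Complex.mul_conj', ← Complex.ofReal_pow]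
  have h : ‖(∑ l, pureState (v l)) i j‖ ≤ ∑ l, (‖v l i‖ ^ 2 + ‖v l j‖ ^ 2) / 2 := by
    rw [Matrix.sum_apply]
    refine (norm_sum_le _ _).trans (Finset.sum_le_sum fun l _ => ?_)
    rw [pureState, vecMulVec_apply, norm_mul, Pi.star_apply, norm_star]
    nlinarith [sq_nonneg (‖v l i‖ - ‖v l j‖)]
  rw [← Finset.sum_div, Finset.sum_add_distrib, ← hre, ← hre] at h
  linarith [hd i, hd j]

theorem continuous_testProb (N : OpMap m n) :
    Continuous fun x : (m × r → ℂ) × Matrix (n × r) (n × r) ℂ => testProb N x.1 x.2 := by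
  have hN : Continuous N := LinearMap.continuous_of_finiteDimensional N
  have h : Continuous fun x : (m × r → ℂ) × Matrix (n × r) (n × r) ℂ =>
      applyLeft N (pureState x.1) := by
    refine continuous_matrix fun p q => ?_
    have h2 : Continuous fun x : (m × r → ℂ) × Matrix (n × r) (n × r) ℂ =>
        (of fun k l => pureState x.1 (k, p.2) (l, q.2) : Matrix m m ℂ) := by
      refine continuous_matrix fun k l => ?_
      simp only [of_apply, pureState, vecMulVec_apply, Pi.star_apply]
      fun_prop
    exact (hN.comp h2).matrix_elem p.1 q.1
  exact Complex.continuous_re.comp ((continuous_snd.matrix_mul h).matrix_trace)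

/-- The infimum of the guaranteed error of a test is attained. -/
theorem exists_optimal_test [DecidableEq m] [DecidableEq n] [DecidableEq r] (N : OpMap m n)
    (C : Set (OpMap m n)) {a c : ℝ}
    (h : ∀ k : ℕ, ∃ (ψ : m × r → ℂ) (Q : Matrix (n × r) (n × r) ℂ), ∑ i, ‖ψ i‖ ^ 2 = 1 ∧
      Q.PosSemidef ∧ (1 - Q).PosSemidef ∧ a ≤ testProb N ψ Q ∧
        ∀ M ∈ C, testProb M ψ Q ≤ c + 1 / ((k : ℝ) + 1)) :
    ∃ (ψ : m × r → ℂ) (Q : Matrix (n × r) (n × r) ℂ), ∑ i, ‖ψ i‖ ^ 2 = 1 ∧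
      Q.PosSemidef ∧ (1 - Q).PosSemidef ∧ a ≤ testProb N ψ Q ∧ ∀ M ∈ C, testProb M ψ Q ≤ c := by
  set B : Set ((m × r → ℂ) × Matrix (n × r) (n × r) ℂ) :=
    {x | ∑ i, ‖x.1 i‖ ^ 2 = 1} ∩ ({x | x.2.PosSemidef} ∩ ({x | (1 - x.2).PosSemidef} ∩
      {x | a ≤ testProb N x.1 x.2}))
  have hB : IsClosed B := by
    refine (isClosed_eq (by fun_prop) continuous_const).inter
      ((isClosed_setOf_posSemidef.preimage continuous_snd).inter
      ((isClosed_setOf_posSemidef.preimage (continuous_const.sub continuous_snd)).inter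
      (isClosed_le continuous_const (continuous_testProb N))))
  have hBc : IsCompact B := by
    have hbox : IsCompact ((Set.univ.pi fun _ => Metric.closedBall 0 1 : Set (m × r → ℂ)) ×ˢ
        (Set.univ.pi fun _ => Set.univ.pi fun _ => Metric.closedBall 0 1 :
          Set (n × r → n × r → ℂ))) :=
      (isCompact_univ_pi fun _ => isCompact_closedBall _ _).prod
        (isCompact_univ_pi fun _ => isCompact_univ_pi fun _ => isCompact_closedBall _ _)
    refine hbox.of_isClosed_subset hB ?_
    rintro ⟨ψ, Q⟩ ⟨h1, h2, h3, -⟩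
    refine ⟨fun i _ => ?_, fun i _ j _ => ?_⟩
    · rw [mem_closedBall_zero_iff]
      have h4 : ‖ψ i‖ ^ 2 ≤ 1 := by
        rw [← (show ∑ i, ‖ψ i‖ ^ 2 = 1 from h1)]
        exact Finset.single_le_sum (f := fun i => ‖ψ i‖ ^ 2) (fun _ _ => sq_nonneg _)
          (Finset.mem_univ i)
      exact (sq_le_one_iff₀ (norm_nonneg _)).1 h4
    · rw [mem_closedBall_zero_iff]
      exact norm_apply_le_one_of_test h2 h3 i j
  -- The sets decrease with `k`. Each constraint is closed for fixed `M`, so no topology on `C` is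
  -- needed.
  set D : ℕ → Set ((m × r → ℂ) × Matrix (n × r) (n × r) ℂ) :=
    fun k => B ∩ ⋂ M ∈ C, {x | testProb M x.1 x.2 ≤ c + 1 / ((k : ℝ) + 1)}
  have hD : ∀ k, IsClosed (D k) := fun k => hB.inter (isClosed_biInter fun M _ =>
    isClosed_le (continuous_testProb M) continuous_const)
  obtain ⟨⟨ψ, Q⟩, hx⟩ := IsCompact.nonempty_iInter_of_sequence_nonempty_isCompact_isClosed D
    (fun k x hx => by
      refine ⟨hx.1, Set.mem_iInter₂.2 fun M hM => ?_⟩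
      have h1 : testProb M x.1 x.2 ≤ c + 1 / (((k + 1 : ℕ) : ℝ) + 1) :=
        Set.mem_iInter₂.1 hx.2 M hM
      refine h1.trans ?_
      push_cast
      gcongr
      linarith)
    (fun k => by
      obtain ⟨ψ, Q, h1, h2, h3, h4, h5⟩ := h k
      exact ⟨(ψ, Q), ⟨h1, h2, h3, h4⟩, Set.mem_iInter₂.2 h5⟩)
    (hBc.of_isClosed_subset (hD 0) Set.inter_subset_left) hD
  rw [Set.mem_iInter] at hx
  obtain ⟨h1, h2, h3, h4⟩ := (hx 0).1
  refine ⟨ψ, Q, h1, h2, h3, h4, fun M hM => ?_⟩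
  have hlim : Filter.Tendsto (fun k : ℕ => c + 1 / ((k : ℝ) + 1)) Filter.atTop (nhds c) := by
    simpa using tendsto_one_div_add_atTop_nhds_zero_nat.const_add c
  exact ge_of_tendsto' hlim fun k => Set.mem_iInter₂.1 (hx k).2 M hM

end Compactness

/-! ### Values of `E_H` and the choice of `K`. -/

section Main

variable {A₀ B₀ A₁ B₁ : Type*} [Fintype A₀] [Fintype B₀] [Fintype A₁] [Fintype B₁]
  [DecidableEq A₁] [DecidableEq B₁] {N : OpMap (A₀ × B₀) (A₁ × B₁)} {ε : ℝ}

theorem exists_sum_norm_sq_eq_one (m : Type*) [Fintype m] [Nonempty m] :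
    ∃ ψ : m × Fin 1 → ℂ, ∑ i, ‖ψ i‖ ^ 2 = 1 := by
  classical
  obtain ⟨a⟩ := ‹Nonempty m›
  refine ⟨fun p => if p = (a, 0) then 1 else 0, ?_⟩
  simp [apply_ite norm, ite_pow]

/-- The trivial test `Q = 1` is passed by every channel with certainty. -/
theorem hypTestEnt_nonneg [Nonempty A₀] [Nonempty B₀] (hN : IsChannel N) (hε : 0 ≤ ε) :
    0 ≤ hypTestEnt ε N := by
  obtain ⟨ψ, hψ⟩ := exists_sum_norm_sq_eq_one (A₀ × B₀)
  have h1 : ∀ M : OpMap (A₀ × B₀) (A₁ × B₁), IsChannel M → testProb M ψ 1 = 1 := fun M hM => by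
    rw [testProb, Matrix.one_mul, trace_applyLeft hM.2, trace_pureState, hψ, Complex.ofReal_re]
  have h := le_hypTestEnt_of_pure (N := N) (δ := ε) (x := 1) hψ PosSemidef.one
    (by rw [sub_self]; exact PosSemidef.zero) (by rw [h1 N hN]; linarith)
    (fun M hM => by rw [h1 M hM.isChannel, inv_one])
  simpa using h

/-- The depolarizing channel is a separable competitor that passes every admissible test with
probability at least `(1 - ε) / d`. -/
theorem hypTestEnt_lt_top [Nonempty A₁] [Nonempty B₁] (hN : IsChannel N) (hε : ε < 1) :
    hypTestEnt ε N < ⊤ := by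
  set d : ℝ := Fintype.card (A₀ × B₀) * Fintype.card (A₁ × B₁)
  refine lt_of_le_of_lt (b := ((-Real.logb 2 ((1 - ε) / d) : ℝ) : EReal)) ?_ (EReal.coe_lt_top _)
  refine iSup_le fun r => iSup_le fun ψ => iSup_le fun _ => iSup_le fun Q => iSup_le fun hQ => ?_
  refine iInf_le_of_le (depolarize (A₀ × B₀) (A₁ × B₁)) <|
    iInf_le_of_le isSeparableChannel_depolarize ?_
  have h1 := hQ.2.2.trans (testProb_le_depolarize hN ψ hQ.1)
  change 1 - ε ≤ d * _ at h1
  set p := testProb (depolarize (A₀ × B₀) (A₁ × B₁)) ψ Q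
  have hd0 : 0 ≤ d := by positivity
  have hd : 0 < d := by
    rcases hd0.eq_or_lt with h | h
    · rw [← h] at h1; linarith
    · exact h
  have hp : (1 - ε) / d ≤ p := by rwa [div_le_iff₀' hd]
  have h0 : 0 < (1 - ε) / d := div_pos (by linarith) hd
  rw [negLog2, if_neg (by linarith), EReal.coe_le_coe_iff, neg_le_neg_iff]
  exact Real.logb_le_logb_of_le one_lt_two h0 hp

/-- Every `K`-swap with `log K² ≤ E_H` is distillable. -/
theorem le_distillableEnt_of_le_hypTestEnt (hN : IsChannel N) {h : ℝ}
    (hh : hypTestEnt ε N = (h : EReal)) {K : ℕ} (hK : 1 ≤ K)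
    (hKh : Real.logb 2 ((K : ℝ) ^ 2) ≤ h) :
    ((Real.logb 2 ((K : ℝ) ^ 2) : ℝ) : EReal) ≤ distillableEnt ε N := by
  classical
  have hK0 : (0 : ℝ) < (K : ℝ) ^ 2 := by
    have : (0 : ℝ) < K := by exact_mod_cast hK
    positivity
  -- Near-optimal tests only give `2^(-h)` plus an error; attainment is needed because `K² = 2^h` is
  -- allowed.
  obtain ⟨ψ, Q, hψ, hQ, hQ', hNQ, hsep⟩ := exists_optimal_test (r := A₀ × B₀) N
      {M | IsSeparableChannel M} (a := 1 - ε) (c := (2 : ℝ) ^ (-h)) fun k => by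
    set c := (2 : ℝ) ^ (-h) + 1 / ((k : ℝ) + 1)
    have hc : (2 : ℝ) ^ (-h) < c := lt_add_of_pos_right _ (by positivity)
    have hc0 : 0 < c := lt_trans (by positivity) hc
    have hlt : ((-Real.logb 2 c : ℝ) : EReal) < hypTestEnt ε N := by
      rw [hh, EReal.coe_lt_coe_iff, neg_lt, Real.lt_logb_iff_rpow_lt one_lt_two hc0]
      exact hc
    rw [hypTestEnt] at hlt
    simp only [lt_iSup_iff] at hlt
    obtain ⟨r, ψ, hψ, Q, ⟨hQ, hQ', hNQ⟩, hlt⟩ := hlt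
    obtain ⟨φ, P, hφ, hP, hP', hPQ⟩ := exists_small_reference hψ hQ hQ'
    refine ⟨φ, P, hφ, hP, hP', hNQ.trans_eq (hPQ N).symm, fun M hM => ?_⟩
    rw [hPQ]
    have h1 := hlt.trans_le (iInf₂_le M hM)
    rw [negLog2] at h1
    split_ifs at h1 with h2
    · exact h2.trans hc0.le
    · rw [EReal.coe_lt_coe_iff, neg_lt_neg_iff,
        Real.logb_lt_logb_iff one_lt_two (not_le.1 h2) hc0] at h1
      exact h1.le
  refine le_distillableEnt_of_test hN hψ hQ hQ' hNQ hK fun M hM => (hsep M hM).trans ?_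
  rw [Real.rpow_neg zero_le_two]
  gcongr
  rwa [← Real.logb_le_iff_le_rpow one_lt_two hK0]

theorem logb_two_pow_sq (k : ℕ) : Real.logb 2 (((2 ^ k : ℕ) : ℝ) ^ 2) = 2 * k := by
  push_cast
  rw [← pow_mul, Real.logb_pow, Real.logb_self_eq_one one_lt_two]
  push_cast
  ring

/-- Take `K = ⌊2^(h/2)⌋`. Then `2^h < (K + 1)² ≤ 2 K²`, where the last step holds for `K ≥ 3` but
fails for `K = 2`; hence the constant `9`. -/
theorem exists_log_sq_between {h : ℝ} (hh : Real.logb 2 9 ≤ h) :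
    ∃ K : ℕ, 1 ≤ K ∧ h - 1 ≤ Real.logb 2 ((K : ℝ) ^ 2) ∧ Real.logb 2 ((K : ℝ) ^ 2) ≤ h := by
  set x := Real.sqrt ((2 : ℝ) ^ h)
  have hx0 : 0 ≤ x := Real.sqrt_nonneg _
  have hx2 : x ^ 2 = (2 : ℝ) ^ h := Real.sq_sqrt (by positivity)
  have hx : 3 ≤ x := by
    rw [Real.logb_le_iff_le_rpow one_lt_two (by norm_num)] at hh
    refine Real.le_sqrt_of_sq_le ?_
    norm_num
    exact hh
  set K := ⌊x⌋₊
  have hK3 : 3 ≤ K := Nat.le_floor hx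
  have hK3' : (3 : ℝ) ≤ K := by exact_mod_cast hK3
  have hKx : (K : ℝ) ≤ x := Nat.floor_le hx0
  have hxK : x < K + 1 := Nat.lt_floor_add_one x
  have hK0 : (0 : ℝ) < (K : ℝ) ^ 2 := by positivity
  refine ⟨K, by omega, ?_, ?_⟩
  · rw [Real.le_logb_iff_rpow_le one_lt_two hK0, Real.rpow_sub_one two_ne_zero, ← hx2]
    nlinarith
  · rw [Real.logb_le_iff_le_rpow one_lt_two hK0, ← hx2]
    gcongr

theorem eq_top_of_forall_logb_le {x : EReal}
    (h : ∀ K : ℕ, 1 ≤ K → ((Real.logb 2 ((K : ℝ) ^ 2) : ℝ) : EReal) ≤ x) : x = ⊤ := by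
  rw [EReal.eq_top_iff_forall_lt]
  intro y
  obtain ⟨k, hk⟩ := exists_nat_gt y
  refine lt_of_lt_of_le ?_ (h (2 ^ k) Nat.one_le_two_pow)
  rw [logb_two_pow_sq, EReal.coe_lt_coe_iff]
  have : (0 : ℝ) ≤ k := Nat.cast_nonneg k
  linarith

end Main

end DynEnt

theorem mainTheorem2 {A₀ B₀ A₁ B₁ : Type*}
    [Fintype A₀] [Fintype B₀] [Fintype A₁] [Fintype B₁]
    [DecidableEq A₁] [DecidableEq B₁]
    [Nonempty A₀] [Nonempty B₀] [Nonempty A₁] [Nonempty B₁]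
    (N : DynEnt.OpMap (A₀ × B₀) (A₁ × B₁)) (hN : DynEnt.IsChannel N) (ε : ℝ) (hε : 0 ≤ ε) :
    DynEnt.distillableEnt ε N ≤ DynEnt.hypTestEnt (2 * ε) N ∧
    (ε < 1 → ∃ h : ℝ, 0 ≤ h ∧ DynEnt.hypTestEnt ε N = (h : EReal) ∧
      (Even ⌊h⌋ → (((⌊h⌋ : ℤ) : ℝ) : EReal) ≤ DynEnt.distillableEnt ε N) ∧
      (Odd ⌊h⌋ →
        ((((⌊h⌋ : ℤ) : ℝ) - 1 : ℝ) : EReal) ≤ DynEnt.distillableEnt ε N ∧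
        (Real.logb 2 9 ≤ h → ((h - 1 : ℝ) : EReal) ≤ DynEnt.distillableEnt ε N))) ∧
    (1 ≤ ε → DynEnt.hypTestEnt ε N = ⊤ ∧ DynEnt.distillableEnt ε N = ⊤) := by
  classical
  refine ⟨DynEnt.distillableEnt_le hε, fun hε1 => ?_, fun hε1 => ?_⟩
  · have h0 := DynEnt.hypTestEnt_nonneg hN hε
    have h1 := DynEnt.hypTestEnt_lt_top hN hε1
    obtain ⟨h, hh⟩ : ∃ h : ℝ, DynEnt.hypTestEnt ε N = (h : EReal) :=
      ⟨_, (EReal.coe_toReal h1.ne (ne_of_gt (EReal.bot_lt_zero.trans_le h0))).symm⟩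
    have hh0 : 0 ≤ h := by rw [hh] at h0; exact_mod_cast h0
    -- Powers of two give `log K² = 2k`, so this choice reaches only even integers.
    have hpow : ∀ k : ℕ, ((2 * k : ℤ) : ℝ) ≤ h →
        (((2 * k : ℤ) : ℝ) : EReal) ≤ DynEnt.distillableEnt ε N := fun k hk => by
      have := DynEnt.le_distillableEnt_of_le_hypTestEnt hN hh (K := 2 ^ k) Nat.one_le_two_pow
      rw [DynEnt.logb_two_pow_sq] at this
      push_cast at hk ⊢
      exact this hk
    have hfl : 0 ≤ ⌊h⌋ := Int.floor_nonneg.2 hh0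
    have hfl' := Int.floor_le h
    refine ⟨h, hh0, hh, ?_, ?_⟩
    · rintro ⟨z, hz⟩
      obtain ⟨k, rfl⟩ := Int.eq_ofNat_of_zero_le (show 0 ≤ z by omega)
      rw [hz, ← two_mul] at hfl' ⊢
      exact hpow k hfl'
    · rintro ⟨z, hz⟩
      obtain ⟨k, rfl⟩ := Int.eq_ofNat_of_zero_le (show 0 ≤ z by omega)
      refine ⟨?_, fun h9 => ?_⟩
      · rw [hz] at hfl' ⊢
        rw [Int.cast_add, Int.cast_one] at hfl' ⊢
        rw [add_sub_cancel_right]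
        exact hpow k (by linarith)
      · obtain ⟨K, hK, hle, hge⟩ := DynEnt.exists_log_sq_between h9
        exact (EReal.coe_le_coe_iff.2 hle).trans
          (DynEnt.le_distillableEnt_of_le_hypTestEnt hN hh hK hge)
  -- Once `1 ≤ ε`, the test `Q = 0` is admissible and never passed, so it serves for every `K`.
  · obtain ⟨ψ, hψ⟩ := DynEnt.exists_sum_norm_sq_eq_one (A₀ × B₀)
    have h0 : ∀ M, DynEnt.testProb (n := A₁ × B₁) M ψ 0 = 0 := fun M => by
      simp [DynEnt.testProb]
    have h1 : ((1 : Matrix ((A₁ × B₁) × Fin 1) ((A₁ × B₁) × Fin 1) ℂ) - 0).PosSemidef := by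
      rw [sub_zero]; exact Matrix.PosSemidef.one
    constructor <;> refine DynEnt.eq_top_of_forall_logb_le fun K hK => ?_
    · refine DynEnt.le_hypTestEnt_of_pure hψ Matrix.PosSemidef.zero h1 ?_ fun M _ => ?_
      · rw [h0]; linarith
      · rw [h0]; positivity
    · refine DynEnt.le_distillableEnt_of_test hN hψ Matrix.PosSemidef.zero h1 ?_ hK fun M _ => ?_
      · rw [h0]; linarith
      · rw [h0]; positivity
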